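/- Let $G=(V,E)$ be a finite directed graph with $n\ge 2$ nodes and let $c\in(0,1)$ be a decay factor. A $\sqrt c$-walk from $u\in V$ moves, at each step, with probability $\sqrt c$ to a uniformly random in-neighbour of the current node and otherwise terminates there (it also terminates at a node without in-neighbours). Let $\pi(w)$, the reverse PageRank of $w$, be the probability that a $\sqrt c$-walk from a uniformly random source terminates at $w$. Let $c_1=12/(1-\sqrt c)^2$, $0<\varepsilon\le 1$ and $0<\delta\le 1$. PRSim has an index for a set $H$ of $j_0$ nodes with the largest reverse PageRanks, $0\le j_0\le n$ arbitrary. The index is built by backward search: with $r_{\max}=\varepsilon/c_1$, $r_0(w,w)=1$ and $r_0(v,w)=0$ for $v\ne w$, each node $v$ at level $\ell$ with $r_\ell(v,w)>r_{\max}$ adds $\sqrt c\, r_\ell(v,w)/d_{in}(z)$ to $r_{\ell+1}(z,w)$ for every out-neighbour $z$ and gets the reserve $\psi_\ell(v,w)=(1-\sqrt c)\,r_\ell(v,w)$; for $w\in H$ and $\ell\ge0$ the list $L_\ell(w)$ holds the tuples $(v,\psi_\ell(v,w))$ with $\psi_\ell(v,w)>r_{\max}$. Out-adjacency lists are sorted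 by ascending in-degree. The query algorithm for a node $u$ runs $f_r=\lceil 3\log(n/\delta)\rceil$ rounds of $d_r=\lceil c_1/\varepsilon^2\rceil$ samples; put $n_r=d_rf_r$. Each sample draws a $\sqrt c$-walk from $u$, which terminates at some $w$ after some number $\ell$ of steps, and then two independent $\sqrt c$-walks from $w$. If these do not visit the same node after the same number $t\ge1$ of steps, then $\widehat{\eta\pi}_\ell(u,w)$ (initially $0$) increases by $1/n_r$, and if moreover $w\notin H$, a variance bounded backward walk from $w$ with target level $\ell$ is run and, with $i$ the current round, $\hat s_B^i(u,v)$ (initially $0$) increases by $\hat\pi_\ell(v,w)/((1-\sqrt c)^2d_r)$ for each $v$ with $\hat\pi_\ell(v,w)\neq 0$. That backward walk starts with $\hat\pi_0(w,w)=1-\sqrt c$ and all other estimates $0$; for $k=0,\dots,\ell-1$ and each $x$ with $a=\hat\pi_k(x,w)\ne 0$, with probability $\sqrt c$ it scans the out-neighbours $y$ of $x$ in order, adding $a/d_{in}(y)$ to $\hat\pi_{k+1}(y,w)$ while $d_{in}(y)\le a/(1-\sqrt c)$, then draws $r$ uniformly from $(0,1)$ and goes on scanning, adding $1-\sqrt c$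 to $\hat\pi_{k+1}(y,w)$ while $d_{in}(y)\le a/(r(1-\sqrt c))$. After the rounds, $\hat s_B(u,v)$ is the median of the $\hat s_B^i(u,v)$ over the rounds $i$; for every $(w,\ell)$ with $\widehat{\eta\pi}_\ell(u,w)>\varepsilon/c_1$ and $w\in H$, each tuple $(v,\psi)$ of $L_\ell(w)$ is retrieved and $\hat s_I(u,v)$ (initially $0$) increases by $\widehat{\eta\pi}_\ell(u,w)\,\psi/(1-\sqrt c)^2$; and all non-zero $\hat s(u,v)=\hat s_B(u,v)+\hat s_I(u,v)$ are returned. The query cost $C(u)$ is the number of elementary operations performed: loop iterations, walk steps, inspected list entries, retrieved tuples, and accesses to hash maps that store only non-zero entries (a median costs the number of the stored values it is taken of). **Theorem.** For every $c\in(0,1)$ there is a constant $K>0$, depending only on $c$, such that for every finite directed graph $G$ with $n\ge2$ nodes, all $\varepsilon,\delta\in(0,1]$, every $j_0$ and every set $H$ of $j_0$ nodes with the largest reverse PageRanks, the expected query cost of PRSim for a query node chosen uniformly at random satisfies $$\mathrm{E}[C]=\frac1n\sum_{u\in V}\mathrm{E}[C(u)]\;\le\; K\cdot\frac{n\log(n/\delta)}{\varepsilon^2}\cdot\sum_{w\in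 V}\pi(w)^2 .$$ -/

import Mathlib

open MeasureTheory

noncomputable section

namespace PRSim

universe u

/-! ### Step counting -/

/-- A value together with the number of elementary operations spent to compute it. The count lives
in `ℕ∞`, as a random walk may (with probability zero) fail to stop. -/
structure Timed (α : Type u) where
  val : α
  cost : ℕ∞

instance : Monad Timed.{u} where
  pure a := ⟨a, 0⟩
  bind x f := ⟨(f x.val).val, x.cost + (f x.val).cost⟩

/-- Spend `k` elementary operations. -/
def tick (k : ℕ∞) : Timed PUnit.{u + 1} := ⟨PUnit.unit, k⟩

/-- `for a in l do s ← f a s`. -/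
def forEach {α : Type*} {σ : Type u} (f : α → σ → Timed σ) : List α → σ → Timed σ
  | [], s => pure s
  | a :: l, s => do
      let s' ← f a s
      forEach f l s'

/-! ### Random numbers

Every call of `rand()` in the query algorithm has its own independent uniform number in `[0,1]`. -/

/-- Two independent uniform random numbers. -/
def randPair : Measure (unitInterval × unitInterval) :=
  (volume : Measure unitInterval).prod volume

instance : IsProbabilityMeasure randPair := by unfold randPair; infer_instance

/-- The random numbers of one walk: at step `t`, `(ρ t).1` decides whether the walk goes on and
`(ρ t).2` selects the in-neighbour. -/
abbrev WalkTape : Type := ℕ → unitInterval × unitInterval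

def walkMeasure : Measure WalkTape := Measure.infinitePi fun _ : ℕ => randPair

instance : IsProbabilityMeasure walkMeasure := by unfold walkMeasure; infer_instance

/-- The random numbers of one backward walk: `(β i x).1` and `(β i x).2` are the numbers `r₀` and
`r` that are drawn when node `x` is processed at level `i`. -/
abbrev BackTape (V : Type u) : Type u := ℕ → V → unitInterval × unitInterval

def backMeasure (V : Type u) [Fintype V] : Measure (BackTape V) :=
  Measure.infinitePi fun _ : ℕ => Measure.pi fun _ : V => randPair

instance (V : Type u) [Fintype V] : IsProbabilityMeasure (backMeasure V) := by
  unfold backMeasure; infer_instance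

/-- The random numbers of one sample: the walk from `u`, the two walks from its end point, and the
backward walk. -/
abbrev SampleTape (V : Type u) : Type u := (WalkTape × WalkTape × WalkTape) × BackTape V

def sampleMeasure (V : Type u) [Fintype V] : Measure (SampleTape V) :=
  (walkMeasure.prod (walkMeasure.prod walkMeasure)).prod (backMeasure V)

instance (V : Type u) [Fintype V] : IsProbabilityMeasure (sampleMeasure V) := by
  unfold sampleMeasure; infer_instance

/-- The random numbers of a query; the entry at `(i, j)` is used by the `j`-th sample of round
`i`. -/
abbrev Tape (V : Type u) : Type u := ℕ × ℕ → SampleTape V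

def tapeMeasure (V : Type u) [Fintype V] : Measure (Tape V) :=
  Measure.infinitePi fun _ : ℕ × ℕ => sampleMeasure V

instance (V : Type u) [Fintype V] : IsProbabilityMeasure (tapeMeasure V) := by
  unfold tapeMeasure; infer_instance

/-! ### Directed graphs; `G.Adj x y` means that there is an edge from `x` to `y` -/

variable {V : Type u} [Fintype V]

open scoped Classical in
/-- The in-adjacency list of `x`. -/
def inList (G : Digraph V) (x : V) : List V := (Finset.univ.filter fun y => G.Adj y x).toList

/-- The in-degree of `x`. -/
def inDeg (G : Digraph V) (x : V) : ℕ := (inList G x).length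

open scoped Classical in
/-- The out-adjacency list of `x`, sorted by ascending in-degree. -/
def outList (G : Digraph V) (x : V) : List V :=
  (Finset.univ.filter fun y => G.Adj x y).toList.mergeSort
    fun y z => decide (inDeg G y ≤ inDeg G z)

/-! ### `√c`-walks and reverse PageRank -/

/-- The in-neighbour of `x` selected by the uniform random number `r`; `none` if `x` has no
in-neighbour (and on the null event `r = 1`). -/
def selectIn (G : Digraph V) (x : V) (r : unitInterval) : Option V :=
  (inList G x)[⌊(r : ℝ) * inDeg G x⌋₊]?

/-- The node that the `√c`-walk from `x` visits at step `t`, or `none` if the walk has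
terminated before step `t`. At each step the walk proceeds with probability `√c` to a uniformly
random in-neighbour; otherwise, and at a node without in-neighbours, it terminates. -/
def walk (G : Digraph V) (c : ℝ) (x : V) (ρ : WalkTape) : ℕ → Option V
  | 0 => some x
  | t + 1 => (walk G c x ρ t).bind fun y =>
      if ((ρ t).1 : ℝ) < √c then selectIn G y (ρ t).2 else none

/-- The walk `p` terminates at node `w` with exactly `ℓ` steps. -/
def EndsAt (p : ℕ → Option V) (w : V) (ℓ : ℕ) : Prop := p ℓ = some w ∧ p (ℓ + 1) = none

/-- The two walks visit the same node after exactly `i` steps, for some `i ≥ 1`. -/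
def Meet (p q : ℕ → Option V) : Prop := ∃ i, 1 ≤ i ∧ ∃ x, p i = some x ∧ q i = some x

/-- Reverse personalized PageRank `π(x, w)`: the probability that a `√c`-walk from `x` terminates
at `w`. -/
def rppr (G : Digraph V) (c : ℝ) (x w : V) : ℝ :=
  walkMeasure.real {ρ | ∃ ℓ, EndsAt (walk G c x ρ) w ℓ}

/-- Reverse PageRank `π(w)`: the probability that a `√c`-walk from a uniformly random source
terminates at `w`. -/
def reversePageRank (G : Digraph V) (c : ℝ) (w : V) : ℝ :=
  (∑ x : V, rppr G c x w) / Fintype.card V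

/-! ### Preprocessing: the index -/

/-- The constant `c₁`. -/
def c₁ (c : ℝ) : ℝ := 12 / (1 - √c) ^ 2

/-- The residue threshold `r_max`. -/
def rMax (c ε : ℝ) : ℝ := ε / c₁ c

/-- `H` consists of `j₀` nodes with the largest reverse PageRanks (ties broken arbitrarily). -/
def IsHubSet (G : Digraph V) (c : ℝ) (j₀ : ℕ) (H : Finset V) : Prop :=
  H.card = j₀ ∧ ∀ w ∈ H, ∀ v ∉ H, reversePageRank G c v ≤ reversePageRank G c w

open scoped Classical in
/-- The residue `r_ℓ(z, w)` of the backward search from `w`, before level `ℓ` is processed: each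
node `v` of level `ℓ` with residue above the threshold pushes `√c · r_ℓ(v, w) / d_in(z)` to each
out-neighbour `z`. -/
def residue (G : Digraph V) (c ε : ℝ) (w : V) : ℕ → V → ℝ
  | 0, z => if z = w then 1 else 0
  | ℓ + 1, z => ∑ v : V, if G.Adj v z ∧ rMax c ε < residue G c ε w ℓ v
      then √c * (residue G c ε w ℓ v / inDeg G z) else 0

open scoped Classical in
/-- The reserve `ψ_ℓ(v, w)`. -/
def reserve (G : Digraph V) (c ε : ℝ) (w : V) (ℓ : ℕ) (v : V) : ℝ :=
  if rMax c ε < residue G c ε w ℓ v then (1 - √c) * residue G c ε w ℓ v else 0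

open scoped Classical in
/-- The list `L_ℓ(w)` of tuples `(v, ψ_ℓ(v, w))` with reserve above the threshold. -/
def indexList (G : Digraph V) (c ε : ℝ) (w : V) (ℓ : ℕ) : List (V × ℝ) :=
  (Finset.univ.filter fun v => rMax c ε < reserve G c ε w ℓ v).toList.map
    fun v => (v, reserve G c ε w ℓ v)

/-! ### The variance bounded backward walk

Finitely supported functions play the role of hash maps which store the non-zero entries only;
an access to such a map is one elementary operation. -/

open scoped Classical in
/-- Scan a list as long as its nodes satisfy `P`, adding `a y` to the entry of each such node `y`;
return the updated map and the part of the list from the first node that fails `P`. Each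
inspected node (and hitting the end of the list) costs one operation. -/
def scan (P : V → Prop) (a : V → ℝ) : List V → (V →₀ ℝ) → Timed ((V →₀ ℝ) × List V)
  | [], m => do
      tick 1
      pure (m, [])
  | y :: l, m => do
      tick 1
      if P y then scan P a l (m + Finsupp.single y (a y)) else pure (m, y :: l)

open scoped Classical in
/-- Process node `x` with current estimate `a`, using the random numbers `r₀` and `r`: update the
map `m` of the estimates of the next level. -/
def push (G : Digraph V) (c : ℝ) (r₀ r : unitInterval) (x : V) (a : ℝ) (m : V →₀ ℝ) :
    Timed (V →₀ ℝ) := do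
  tick 1
  if (r₀ : ℝ) < √c then do
    let s ← scan (fun y => (inDeg G y : ℝ) ≤ a / (1 - √c)) (fun y => a / inDeg G y)
      (outList G x) m
    let s' ← scan (fun y => (inDeg G y : ℝ) ≤ a / (r * (1 - √c))) (fun _ => 1 - √c) s.2 s.1
    pure s'.1
  else pure m

/-- Variance bounded backward walk from `w` with target level `ℓ`: the map of all non-zero
estimates of the `ℓ`-hop RPPR to `w`. -/
def backwardWalk (G : Digraph V) (c : ℝ) (w : V) (β : BackTape V) : ℕ → Timed (V →₀ ℝ)
  | 0 => do
      tick 1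
      pure (Finsupp.single w (1 - √c))
  | i + 1 => do
      let e ← backwardWalk G c w β i
      tick 1
      forEach (fun x m => push G c (β i x).1 (β i x).2 x (e x) m) e.support.toList 0

/-! ### The query algorithm -/

/-- Sample a walk; every visited node costs one operation. -/
def sampleWalk (G : Digraph V) (c : ℝ) (x : V) (ρ : WalkTape) : Timed (ℕ → Option V) :=
  ⟨walk G c x ρ, {t | walk G c x ρ t ≠ none}.encard⟩

open scoped Classical in
/-- The node at which the walk terminates and its number of steps (`none` for an infinite walk,
an event of probability zero). -/
def endPoint (p : ℕ → Option V) : Option (V × ℕ) :=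
  if h : ∃ e : V × ℕ, EndsAt p e.1 e.2 then some h.choose else none

/-- The estimators `η̂π_ℓ(u, w)`, stored under the key `(w, ℓ)`, and `ŝ_B^i(u, v)`, stored under
the key `(i, v)`. -/
structure QueryState (V : Type u) where
  etaPi : V × ℕ →₀ ℝ
  sB : ℕ × V →₀ ℝ

/-- The number `d_r` of samples in a round. -/
def samplesPerRound (c ε : ℝ) : ℕ := ⌈c₁ c / ε ^ 2⌉₊

variable (V) in
/-- The number `f_r` of rounds. -/
def numRounds (δ : ℝ) : ℕ := ⌈3 * Real.log (Fintype.card V / δ)⌉₊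

variable (V) in
/-- The total number `n_r` of samples. -/
def numSamples (c ε δ : ℝ) : ℕ := samplesPerRound c ε * numRounds V δ

open scoped Classical in
/-- One sample of round `i`. The comparison of the two walks from `w` costs one operation for
each step at which both of them are still alive. -/
def sampleStep (G : Digraph V) (c ε δ : ℝ) (H : Finset V) (x : V) (i : ℕ) (σ : SampleTape V)
    (s : QueryState V) : Timed (QueryState V) := do
  tick 1
  let p ← sampleWalk G c x σ.1.1
  match endPoint p with
  | none => pure s
  | some (w, ℓ) => do
    let p₁ ← sampleWalk G c w σ.1.2.1
    let p₂ ← sampleWalk G c w σ.1.2.2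
    tick {t | p₁ t ≠ none ∧ p₂ t ≠ none}.encard
    if Meet p₁ p₂ then pure s
    else do
      tick 1
      let etaPi := s.etaPi + Finsupp.single (w, ℓ) (1 / (numSamples V c ε δ : ℝ))
      if w ∈ H then pure ⟨etaPi, s.sB⟩
      else do
        let e ← backwardWalk G c w σ.2 ℓ
        let sB ← forEach (fun v m => do
            tick 1
            pure (m + Finsupp.single (i, v) (e v / ((1 - √c) ^ 2 * samplesPerRound c ε))))
          e.support.toList s.sB
        pure ⟨etaPi, sB⟩

/-- The median of a list of real numbers (the upper one for an even number of entries). -/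
def median (l : List ℝ) : ℝ := (l.mergeSort fun a b => decide (a ≤ b)).getD (l.length / 2) 0

open scoped Classical in
/-- The median stage: `ŝ_B(u, v)` for every `v` with a non-zero `ŝ_B^i(u, v)`. The `ŝ_B^i(u, v)`
are non-negative, so their median is zero or the result of a selection among the stored non-zero
ones; its cost is the number of these (selection in linear time). -/
def medianStage (f : ℕ) (sB : ℕ × V →₀ ℝ) : Timed (V →₀ ℝ) :=
  forEach (fun v m => do
      tick ({i | sB (i, v) ≠ 0} : Set ℕ).encard
      pure (m + Finsupp.single v (median ((List.range f).map fun i => sB (i, v)))))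
    (sB.support.image Prod.snd).toList 0

open scoped Classical in
/-- The index stage: for every stored `(w, ℓ)` whose estimate exceeds `ε / c₁` and whose node is in
the index, retrieve all tuples of `L_ℓ(w)`. -/
def indexStage (G : Digraph V) (c ε : ℝ) (H : Finset V) (etaPi : V × ℕ →₀ ℝ) :
    Timed (V →₀ ℝ) :=
  forEach (fun k m => do
      tick 1
      if ε / c₁ c < etaPi k ∧ k.1 ∈ H then
        forEach (fun (q : V × ℝ) m => do
            tick 1
            pure (m + Finsupp.single q.1 (etaPi k * q.2 / (1 - √c) ^ 2)))
          (indexList G c ε k.1 k.2) m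
      else pure m)
    etaPi.support.toList 0

/-- The query algorithm of PRSim for the query node `x`, with hub nodes `H`: the map of all non-zero
estimates `ŝ(x, v)`, with the number of operations spent. -/
def query (G : Digraph V) (c ε δ : ℝ) (H : Finset V) (x : V) (ω : Tape V) :
    Timed (V →₀ ℝ) := do
  tick 1
  let s ← forEach (fun i s =>
      forEach (fun j s => sampleStep G c ε δ H x i (ω (i, j)) s)
        (List.range (samplesPerRound c ε)) s)
    (List.range (numRounds V δ)) (⟨0, 0⟩ : QueryState V)
  let sB ← medianStage (numRounds V δ) s.sB
  let sI ← indexStage G c ε H s.etaPi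
  tick (sB.support.card + sI.support.card : ℕ)
  pure (sB + sI)

/-- The expected query cost for a uniformly random query node: the average over all query nodes
`x` of the expected cost of the query from `x`. -/
def expectedQueryCost (G : Digraph V) (c ε δ : ℝ) (H : Finset V) : ENNReal :=
  (∑ x : V, ∫⁻ ω, ((query G c ε δ H x ω).cost : ENNReal) ∂tapeMeasure V) / Fintype.card V

end PRSim

end

open MeasureTheory ProbabilityTheory

noncomputable section

namespace PRSim

/-! ### Walks -/

/-! A query makes n_r samples, of order log(n/δ)/ε², so the task is to bound the expected cost of
one sample and to charge the later stages of the query to the samples.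

Every increment made by a scan of the backward walk is at least 1 - √c (`pushIncr_eq_zero_or`), so
inspected neighbours and stored entries are paid for by estimate mass: up to constants, a backward
walk from w to level ℓ costs ℓ + 1 plus the total of its estimates on levels 0, …, ℓ
(`backwardWalk_cost_le`). In expectation the estimate of v on level i is at most 1 - √c times the
probability that a √c-walk from v is at w after i steps, hence at most the probability that it
terminates there after i steps (`lintegral_estimate_le`, `mul_hopProb_le_endProb`). Summing over i
and v gives at most ∑_v π(v,w) = nπ(w).

A potential function (`potential`, `sampleStep_amortized`) spreads the median and index stages over
the samples. The list L_ℓ(w) has at most nπ(w)/r_max tuples (`length_indexList_le`) and is read only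
when its estimate exceeds r_max, so a unit of that estimate is responsible for O(nπ(w)/r_max²)
operations. Each sample adds only 1/n_r to the estimates, hence this term does not pick up a factor
n_r, and r_max⁻² = c₁²/ε².

Both costs are charged at every end point w. The backward walk and the forward walk use independent
random numbers, so a sample from u costs O(1) plus a multiple of ∑_w π(u,w)·nπ(w) in expectation;
averaging over u turns this sum into n∑π(w)² (`expectedQueryCost_le`). Finally n∑π(w)² ≥ (∑π(w))² ≥
(1 - √c)² by Cauchy–Schwarz, which absorbs the graph-independent cost, and log(n/δ) ≥ 1/2 absorbs
the roundings. -/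

theorem one_sub_sqrt_pos {c : ℝ} (hc : c < 1) : 0 < 1 - √c :=
  sub_pos.2 ((Real.sqrt_lt' one_pos).2 (by simpa using hc))

/-- In a sequence of i.i.d. random variables, the `t`-th one is integrated out of a function of
itself and of a quantity that is determined by the earlier ones. -/
theorem lintegral_infinitePi_adapted {α β : Type*} [MeasurableSpace α] [MeasurableSpace β]
    (μ : Measure α) [IsProbabilityMeasure μ] (t : ℕ) {X : (ℕ → α) → β} (hX : Measurable X)
    (hdep : ∀ ρ ρ', (∀ i < t, ρ i = ρ' i) → X ρ = X ρ')
    {F : β → α → ENNReal} (hF : Measurable (Function.uncurry F)) :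
    ∫⁻ ρ, F (X ρ) (ρ t) ∂Measure.infinitePi (fun _ : ℕ => μ) =
      ∫⁻ ρ, ∫⁻ a, F (X ρ) a ∂μ ∂Measure.infinitePi (fun _ : ℕ => μ) := by
  set P := Measure.infinitePi (fun _ : ℕ => μ) with hP
  obtain ⟨a₀⟩ : Nonempty α := μ.nonempty_of_neZero
  have hind : iIndepFun (fun (i : ℕ) (ρ : ℕ → α) => ρ i) P :=
    iIndepFun_infinitePi (P := fun _ : ℕ => μ) (X := fun _ => id) (fun _ => measurable_id)
  have h2 := hind.indepFun_finset (Finset.range t) {t} (by simp) (fun i => measurable_pi_apply i)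
  -- `X` ignores the filler `a₀`, so it factors through the coordinates below `t`; independence of
  -- disjoint blocks of coordinates then applies.
  let ext : (Finset.range t → α) → ℕ → α :=
    fun g i => if h : i ∈ Finset.range t then g ⟨i, h⟩ else a₀
  have hext : Measurable ext := by
    refine measurable_pi_lambda _ fun i => ?_
    by_cases h : i ∈ Finset.range t
    · simp only [ext, h, dif_pos]; exact measurable_pi_apply _
    · simp only [ext, h, dif_neg, not_false_eq_true]; exact measurable_const
  have h3 : IndepFun X (fun ρ => ρ t) P := by
    have h4 := h2.comp (hX.comp hext)
      (measurable_pi_apply (⟨t, Finset.mem_singleton_self t⟩ : ({t} : Finset ℕ)))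
    have hXe : X = (X ∘ ext) ∘ fun ρ (i : Finset.range t) => ρ i := by
      funext ρ
      refine hdep _ _ fun i hi => ?_
      simp [ext, hi]
    rw [hXe]
    exact h4
  have h5 := h3.map_prod_eq_prod_map_map hX.aemeasurable (measurable_pi_apply t).aemeasurable
  have h6 : P.map (fun ρ => ρ t) = μ := (measurePreserving_eval_infinitePi (fun _ : ℕ => μ) t).map_eq
  rw [h6] at h5
  calc ∫⁻ ρ, F (X ρ) (ρ t) ∂P
      = ∫⁻ z, Function.uncurry F z ∂(P.map fun ρ => (X ρ, ρ t)) := by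
        rw [lintegral_map hF (hX.prodMk (measurable_pi_apply t))]; rfl
    _ = ∫⁻ b, ∫⁻ a, F b a ∂μ ∂(P.map X) := by
        rw [h5, lintegral_prod _ hF.aemeasurable]; rfl
    _ = _ := by
        rw [lintegral_map _ hX]
        exact Measurable.lintegral_prod_right hF

universe u

section Walk

variable {V : Type u} [Fintype V]

/-! ### Selecting a uniformly random in-neighbour -/

theorem mem_inList {G : Digraph V} {x y : V} : y ∈ inList G x ↔ G.Adj y x := by
  simp [inList]

theorem nodup_inList (G : Digraph V) (x : V) : (inList G x).Nodup := Finset.nodup_toList _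

theorem inDeg_pos {G : Digraph V} {x y : V} (h : G.Adj y x) : 0 < inDeg G x :=
  List.length_pos_of_mem (mem_inList.2 h)

/-- The event is the half-open interval [j/d, (j+1)/d), so rounding down picks each list index with
the same probability. -/
theorem volume_floor_mul_eq {d j : ℕ} (hj : j < d) :
    volume {r : unitInterval | ⌊(r : ℝ) * d⌋₊ = j} = (d : ENNReal)⁻¹ := by
  have hd : (0 : ℝ) < d := by exact_mod_cast (Nat.zero_le j).trans_lt hj
  have himg : (Subtype.val '' {r : unitInterval | ⌊(r : ℝ) * d⌋₊ = j} : Set ℝ) =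
      Set.Ico ((j : ℝ) / d) ((j + 1 : ℝ) / d) := by
    ext r
    simp only [Set.mem_image, Set.mem_ofPred_eq, Subtype.exists, exists_and_right, exists_eq_right,
      Set.mem_Ico]
    have key : 0 ≤ r → (⌊r * d⌋₊ = j ↔ (j : ℝ) / d ≤ r ∧ r < (j + 1 : ℝ) / d) := fun h => by
      rw [Nat.floor_eq_iff (by positivity), div_le_iff₀ hd, lt_div_iff₀ hd]
    constructor
    · rintro ⟨h0, h⟩
      exact (key h0.1).1 h
    · intro h
      have h0 : 0 ≤ r := le_trans (by positivity) h.1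
      have h1 : r ≤ 1 := h.2.le.trans (by
        rw [div_le_one hd]; exact_mod_cast hj)
      exact ⟨⟨h0, h1⟩, (key h0).2 h⟩
  rw [unitInterval.volume_apply, himg, Real.volume_Ico, ← sub_div, add_sub_cancel_left,
    one_div, ENNReal.ofReal_inv_of_pos hd, ENNReal.ofReal_natCast]

open scoped Classical in
theorem volume_selectIn_eq (G : Digraph V) (x y : V) :
    volume {r | selectIn G x r = some y} = if G.Adj y x then (inDeg G x : ENNReal)⁻¹ else 0 := by
  split_ifs with h
  · obtain ⟨j, hj, rfl⟩ := List.mem_iff_getElem.1 (mem_inList.2 h)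
    rw [inDeg, ← volume_floor_mul_eq hj]
    congr 1
    ext r
    simp only [selectIn, Set.mem_ofPred_eq]
    rw [List.getElem?_eq_some_iff]
    constructor
    · rintro ⟨h1, h2⟩
      exact (nodup_inList G x).getElem_inj_iff.1 h2
    · rintro h1
      subst h1
      exact ⟨hj, rfl⟩
  · convert measure_empty (μ := (volume : Measure unitInterval))
    ext r
    simp only [selectIn, Set.mem_ofPred_eq, Set.mem_empty_iff_false, iff_false]
    intro h1
    exact h (mem_inList.1 (List.mem_of_getElem? h1))

theorem measurableSet_selectIn_eq (G : Digraph V) (x : V) (o : Option V) :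
    MeasurableSet {r | selectIn G x r = o} := by
  have hf : Measurable fun r : unitInterval => ⌊(r : ℝ) * inDeg G x⌋₊ :=
    Nat.measurable_floor.comp (by fun_prop)
  exact hf (MeasurableSpace.measurableSet_top (s := {j | (inList G x)[j]? = o}))

theorem volume_coe_lt {s : ℝ} (h1 : s ≤ 1) :
    volume {r : unitInterval | (r : ℝ) < s} = ENNReal.ofReal s := by
  have himg : (Subtype.val '' {r : unitInterval | (r : ℝ) < s} : Set ℝ) = Set.Ico 0 s := by
    ext r
    simp only [Set.mem_image, Set.mem_ofPred_eq, Subtype.exists, exists_and_right, exists_eq_right,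
      Set.mem_Ico]
    exact ⟨fun ⟨h, h'⟩ => ⟨h.1, h'⟩, fun h => ⟨⟨h.1, h.2.le.trans h1⟩, h.2⟩⟩
  rw [unitInterval.volume_apply, himg, Real.volume_Ico, sub_zero]

theorem volume_coe_le_le (s : ℝ) :
    volume {r : unitInterval | (r : ℝ) ≤ s} ≤ ENNReal.ofReal s := by
  have himg : (Subtype.val '' {r : unitInterval | (r : ℝ) ≤ s} : Set ℝ) ⊆ Set.Icc 0 s := by
    rintro _ ⟨r, hr, rfl⟩
    exact ⟨r.2.1, hr⟩
  rw [unitInterval.volume_apply]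
  exact (measure_mono himg).trans (by rw [Real.volume_Icc, sub_zero])

/-- One step of a `√c`-walk from `y`. -/
def walkStep (G : Digraph V) (c : ℝ) (y : V) (a : unitInterval × unitInterval) : Option V :=
  if (a.1 : ℝ) < √c then selectIn G y a.2 else none

theorem walk_succ (G : Digraph V) (c : ℝ) (x : V) (ρ : WalkTape) (t : ℕ) :
    walk G c x ρ (t + 1) = (walk G c x ρ t).bind fun y => walkStep G c y (ρ t) := rfl

open scoped Classical in
/-- The probability that a `√c`-walk at `x` proceeds to `y`. -/
def stepProb (G : Digraph V) (c : ℝ) (x y : V) : ENNReal :=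
  if G.Adj y x then ENNReal.ofReal √c * (inDeg G x : ENNReal)⁻¹ else 0

open scoped Classical in
/-- The probability that a `√c`-walk from `x` is at node `y` after `k` steps. -/
def hopProb (G : Digraph V) (c : ℝ) : ℕ → V → V → ENNReal
  | 0, x, y => if x = y then 1 else 0
  | k + 1, x, y => ∑ z, stepProb G c x z * hopProb G c k z y

theorem hopProb_succ (G : Digraph V) (c : ℝ) (k : ℕ) (x y : V) :
    hopProb G c (k + 1) x y = ∑ z, stepProb G c x z * hopProb G c k z y := rfl

/-- Splitting off the last step suits the forward walk, whose tape is revealed in order; the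
defining split at the first step suits the backward walk and the backward search, which move away
from the target. -/
theorem hopProb_succ' (G : Digraph V) (c : ℝ) (k : ℕ) (x y : V) :
    hopProb G c (k + 1) x y = ∑ z, hopProb G c k x z * stepProb G c z y := by
  classical
  induction k generalizing x with
  | zero => simp [hopProb]
  | succ k ih =>
    rw [hopProb_succ]
    simp_rw [ih, Finset.mul_sum]
    rw [Finset.sum_comm]
    refine Finset.sum_congr rfl fun z _ => ?_
    rw [hopProb_succ, Finset.sum_mul]
    exact Finset.sum_congr rfl fun _ _ => (mul_assoc _ _ _).symm

theorem measurableSet_walkStep_eq (G : Digraph V) (c : ℝ) (y : V) (o : Option V) :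
    MeasurableSet {a | walkStep G c y a = o} := by
  have h1 : MeasurableSet {a : unitInterval × unitInterval | (a.1 : ℝ) < √c} :=
    measurableSet_lt (by fun_prop) measurable_const
  have h2 : MeasurableSet {a : unitInterval × unitInterval | selectIn G y a.2 = o} :=
    measurable_snd (measurableSet_selectIn_eq G y o)
  by_cases ho : none = o
  · convert (h1.inter h2).union h1.compl using 1
    ext a
    by_cases h : (a.1 : ℝ) < √c <;> simp [walkStep, h, ho]
  · convert h1.inter h2 using 1
    ext a
    by_cases h : (a.1 : ℝ) < √c <;> simp [walkStep, h, ho]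

theorem randPair_walkStep_eq (G : Digraph V) {c : ℝ} (hc : c ≤ 1) (y z : V) :
    randPair {a | walkStep G c y a = some z} = stepProb G c y z := by
  have h : {a | walkStep G c y a = some z} =
      {r : unitInterval | (r : ℝ) < √c} ×ˢ {r | selectIn G y r = some z} := by
    ext a
    by_cases h : (a.1 : ℝ) < √c <;> simp [walkStep, h]
  rw [h, randPair, Measure.prod_prod, volume_coe_lt (Real.sqrt_le_one.2 hc), volume_selectIn_eq,
    stepProb, mul_ite, mul_zero]

theorem measurableSet_walkStep_tape (G : Digraph V) (c : ℝ) (y : V) (o : Option V) (t : ℕ) :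
    MeasurableSet {ρ : WalkTape | walkStep G c y (ρ t) = o} := by
  have h : Measurable fun ρ : WalkTape => ρ t := measurable_pi_apply t
  exact h (measurableSet_walkStep_eq G c y o)

theorem measurableSet_walk_eq_some (G : Digraph V) (c : ℝ) (x : V) (t : ℕ) (y : V) :
    MeasurableSet {ρ | walk G c x ρ t = some y} := by
  induction t generalizing y with
  | zero =>
    have h : {ρ : WalkTape | walk G c x ρ 0 = some y} = {_ρ | x = y} := by
      ext ρ; simp [walk]
    rw [h]
    exact MeasurableSet.const _
  | succ t ih =>
    have h : {ρ | walk G c x ρ (t + 1) = some y} =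
        ⋃ z, {ρ | walk G c x ρ t = some z} ∩ {ρ | walkStep G c z (ρ t) = some y} := by
      ext ρ
      simp [walk_succ, Option.bind_eq_some_iff]
    rw [h]
    exact MeasurableSet.iUnion fun z => (ih z).inter
      (measurableSet_walkStep_tape G c z (some y) t)

theorem setOf_walk_ne_none (G : Digraph V) (c : ℝ) (x : V) (t : ℕ) :
    {ρ | walk G c x ρ t ≠ none} = ⋃ y, {ρ | walk G c x ρ t = some y} := by
  ext ρ
  simp [Option.ne_none_iff_exists']

theorem measurableSet_walk_ne_none (G : Digraph V) (c : ℝ) (x : V) (t : ℕ) :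
    MeasurableSet {ρ | walk G c x ρ t ≠ none} := by
  rw [setOf_walk_ne_none]
  exact MeasurableSet.iUnion fun y => measurableSet_walk_eq_some G c x t y

theorem measurableSet_endsAt (G : Digraph V) (c : ℝ) (x w : V) (ℓ : ℕ) :
    MeasurableSet {ρ | EndsAt (walk G c x ρ) w ℓ} := by
  have h := (measurableSet_walk_eq_some G c x ℓ w).inter
    (measurableSet_walk_ne_none G c x (ℓ + 1)).compl
  convert h using 1
  ext ρ
  simp [EndsAt]

theorem walk_congr (G : Digraph V) (c : ℝ) (x : V) {ρ ρ' : WalkTape} {t : ℕ}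
    (h : ∀ i < t, ρ i = ρ' i) : walk G c x ρ t = walk G c x ρ' t := by
  induction t with
  | zero => rfl
  | succ t ih =>
    rw [walk_succ, walk_succ, ih fun i hi => h i (hi.trans t.lt_succ_self), h t t.lt_succ_self]

/-- The random numbers used at step `t` are independent of the position at step `t`. -/
theorem walkMeasure_inter (G : Digraph V) (c : ℝ) (x y : V) (t : ℕ)
    {s : Set (unitInterval × unitInterval)} (hs : MeasurableSet s) :
    walkMeasure ({ρ | walk G c x ρ t = some y} ∩ {ρ | ρ t ∈ s}) =
      walkMeasure {ρ | walk G c x ρ t = some y} * randPair s := by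
  set A := {ρ | walk G c x ρ t = some y} with hA
  have hAm : MeasurableSet A := measurableSet_walk_eq_some G c x t y
  have hsm : MeasurableSet {ρ : WalkTape | ρ t ∈ s} := measurable_pi_apply t hs
  have h := lintegral_infinitePi_adapted randPair t
    (X := A.indicator (1 : WalkTape → ENNReal)) (measurable_one.indicator hAm)
    (fun ρ ρ' h => by
      have : ρ ∈ A ↔ ρ' ∈ A := by simp only [hA, Set.mem_ofPred_eq, walk_congr G c x h]
      by_cases h1 : ρ ∈ A <;> simp [h1, this.1, this.not.1])
    (F := fun b a => b * s.indicator 1 a)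
    (measurable_fst.mul ((measurable_one.indicator hs).comp measurable_snd))
  have h1 : ∀ ρ : WalkTape, A.indicator (1 : WalkTape → ENNReal) ρ * s.indicator 1 (ρ t) =
      (A ∩ {ρ | ρ t ∈ s}).indicator 1 ρ := fun ρ => by
    rw [Set.inter_indicator_one]; rfl
  simp only [h1] at h
  rw [lintegral_indicator_one (hAm.inter hsm)] at h
  rw [walkMeasure, h]
  have h2 : ∀ b : ENNReal, ∫⁻ a, b * s.indicator 1 a ∂randPair = b * randPair s := fun b => by
    rw [lintegral_const_mul _ (measurable_one.indicator hs), lintegral_indicator_one hs]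
  simp only [h2]
  rw [lintegral_mul_const _ (measurable_one.indicator hAm), lintegral_indicator_one hAm]

theorem walkMeasure_walk_eq_some (G : Digraph V) {c : ℝ} (hc : c ≤ 1) (x : V) (t : ℕ) (y : V) :
    walkMeasure {ρ | walk G c x ρ t = some y} = hopProb G c t x y := by
  classical
  induction t generalizing y with
  | zero =>
    by_cases h : x = y <;> simp [walk, hopProb, h]
  | succ t ih =>
    have h : {ρ | walk G c x ρ (t + 1) = some y} =
        ⋃ z, ({ρ | walk G c x ρ t = some z} ∩ {ρ | ρ t ∈ {a | walkStep G c z a = some y}}) := by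
      ext ρ
      simp [walk_succ, Option.bind_eq_some_iff]
    rw [h, measure_iUnion, tsum_fintype, hopProb_succ']
    · refine Finset.sum_congr rfl fun z _ => ?_
      rw [walkMeasure_inter G c x z t (measurableSet_walkStep_eq G c z (some y)), ih,
        randPair_walkStep_eq G hc]
    · intro z z' hz
      refine Set.disjoint_left.2 fun ρ h1 h2 => hz ?_
      exact Option.some_injective _ (h1.1.symm.trans h2.1)
    · exact fun z => (measurableSet_walk_eq_some G c x t z).inter
        (measurableSet_walkStep_tape G c z (some y) t)

theorem sum_stepProb_le (G : Digraph V) (c : ℝ) (x : V) :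
    ∑ y, stepProb G c x y ≤ ENNReal.ofReal √c := by
  classical
  simp only [stepProb]
  rw [← Finset.sum_filter, Finset.sum_const, nsmul_eq_mul]
  have h : (Finset.univ.filter fun y => G.Adj y x).card = inDeg G x := by
    simp only [inDeg, inList, Finset.length_toList]
  rw [h, mul_left_comm]
  -- In-degree 0 is included, as 0 · ⊤ = 0 in `ENNReal`.
  exact mul_le_of_le_one_right' (ENNReal.mul_inv_le_one _)

theorem sum_hopProb_le (G : Digraph V) (c : ℝ) (k : ℕ) (x : V) :
    ∑ y, hopProb G c k x y ≤ ENNReal.ofReal √c ^ k := by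
  classical
  induction k generalizing x with
  | zero => simp [hopProb]
  | succ k ih =>
    simp_rw [hopProb_succ]
    rw [Finset.sum_comm]
    simp_rw [← Finset.mul_sum]
    calc ∑ z, stepProb G c x z * ∑ y, hopProb G c k z y
        ≤ ∑ z, stepProb G c x z * ENNReal.ofReal √c ^ k := by
          gcongr with z; exact ih z
      _ ≤ _ := by
          rw [← Finset.sum_mul, pow_succ']
          gcongr
          exact sum_stepProb_le G c x

/-- The probability that a `√c`-walk from `x` terminates at `w` after exactly `ℓ` steps. -/
def endProb (G : Digraph V) (c : ℝ) (x w : V) (ℓ : ℕ) : ENNReal :=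
  walkMeasure {ρ | EndsAt (walk G c x ρ) w ℓ}

theorem endProb_le_hopProb (G : Digraph V) {c : ℝ} (hc : c ≤ 1) (x w : V) (ℓ : ℕ) :
    endProb G c x w ℓ ≤ hopProb G c ℓ x w := by
  rw [← walkMeasure_walk_eq_some G hc]
  exact measure_mono fun ρ h => h.1

theorem randPair_stop {c : ℝ} (hc : c ≤ 1) :
    randPair {a | ¬ (a.1 : ℝ) < √c} = ENNReal.ofReal (1 - √c) := by
  have h : {a : unitInterval × unitInterval | ¬ (a.1 : ℝ) < √c} =
      {r : unitInterval | (r : ℝ) < √c}ᶜ ×ˢ Set.univ := by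
    ext a; simp
  rw [h, randPair, Measure.prod_prod, measure_univ, mul_one,
    prob_compl_eq_one_sub (measurableSet_lt measurable_subtype_coe measurable_const),
    volume_coe_lt (Real.sqrt_le_one.2 hc), ENNReal.ofReal_sub _ (Real.sqrt_nonneg c),
    ENNReal.ofReal_one]

/-- At `w` the coin stops the walk with probability 1 - √c, independently of the past; a node
without in-neighbours stops it anyway, hence no equality. This converts hop probabilities into
summands of π(x,w). -/
theorem mul_hopProb_le_endProb (G : Digraph V) {c : ℝ} (hc : c ≤ 1) (x w : V) (ℓ : ℕ) :
    ENNReal.ofReal (1 - √c) * hopProb G c ℓ x w ≤ endProb G c x w ℓ := by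
  have hlt : MeasurableSet {a : unitInterval × unitInterval | (a.1 : ℝ) < √c} :=
    measurableSet_lt (by fun_prop) measurable_const
  have hs : MeasurableSet {a : unitInterval × unitInterval | ¬ (a.1 : ℝ) < √c} := hlt.compl
  rw [← randPair_stop hc, ← walkMeasure_walk_eq_some G hc, mul_comm,
    ← walkMeasure_inter G c x w ℓ hs]
  refine measure_mono ?_
  rintro ρ ⟨h1, h2⟩
  refine ⟨h1, ?_⟩
  simp only [Set.mem_ofPred_eq] at h1 h2
  simp [walk_succ, h1, walkStep, h2]

theorem walk_eq_none_of_le (G : Digraph V) (c : ℝ) (x : V) (ρ : WalkTape) {s t : ℕ} (h : s ≤ t)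
    (hs : walk G c x ρ s = none) : walk G c x ρ t = none := by
  induction t, h using Nat.le_induction with
  | base => exact hs
  | succ t _ ih => rw [walk_succ, ih, Option.bind_none]

theorem endsAt_unique (G : Digraph V) (c : ℝ) (x : V) (ρ : WalkTape) {w w' : V} {ℓ ℓ' : ℕ}
    (h : EndsAt (walk G c x ρ) w ℓ) (h' : EndsAt (walk G c x ρ) w' ℓ') : ℓ = ℓ' := by
  rcases lt_trichotomy ℓ ℓ' with hl | hl | hl
  · have := walk_eq_none_of_le G c x ρ hl h.2
    rw [h'.1] at this; cases this
  · exact hl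
  · have := walk_eq_none_of_le G c x ρ hl h'.2
    rw [h.1] at this; cases this

theorem tsum_endProb (G : Digraph V) (c : ℝ) (x w : V) :
    ∑' ℓ, endProb G c x w ℓ = ENNReal.ofReal (rppr G c x w) := by
  rw [rppr, Measure.real, ENNReal.ofReal_toReal (measure_ne_top _ _), Set.ofPred_exists,
    measure_iUnion]
  · rfl
  · intro ℓ ℓ' hl
    exact Set.disjoint_left.2 fun ρ h1 h2 => hl (endsAt_unique G c x ρ h1 h2)
  · exact fun ℓ => measurableSet_endsAt G c x w ℓ

/-- The cost of a walk. -/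
def walkCost (G : Digraph V) (c : ℝ) (x : V) (ρ : WalkTape) : ENNReal :=
  ∑' t, {ρ | walk G c x ρ t ≠ none}.indicator 1 ρ

theorem sampleWalk_cost (G : Digraph V) (c : ℝ) (x : V) (ρ : WalkTape) :
    ((sampleWalk G c x ρ).cost : ENNReal) = walkCost G c x ρ := by
  rw [sampleWalk, ← ENNReal.tsum_set_one, tsum_subtype _ (fun _ => (1 : ENNReal))]
  rfl

theorem measurable_walkCost (G : Digraph V) (c : ℝ) (x : V) : Measurable (walkCost G c x) :=
  Measurable.tsum fun t =>
    measurable_one.indicator (measurableSet_walk_ne_none G c x t)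

/-- The expected number of visited nodes is the sum over t of the survival probabilities, each at
most √c ^ t: a geometric series. -/
theorem lintegral_walkCost_le (G : Digraph V) {c : ℝ} (hc : c ≤ 1) (x : V) :
    ∫⁻ ρ, walkCost G c x ρ ∂walkMeasure ≤ (ENNReal.ofReal (1 - √c))⁻¹ := by
  simp only [walkCost]
  rw [lintegral_tsum fun t =>
    (measurable_one.indicator (measurableSet_walk_ne_none G c x t)).aemeasurable]
  calc ∑' t, ∫⁻ ρ, {ρ | walk G c x ρ t ≠ none}.indicator 1 ρ ∂walkMeasure
      ≤ ∑' t, ENNReal.ofReal √c ^ t := by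
        gcongr with t
        rw [lintegral_indicator_one (measurableSet_walk_ne_none G c x t), setOf_walk_ne_none]
        refine (measure_iUnion_le _).trans ?_
        rw [tsum_fintype]
        simp_rw [walkMeasure_walk_eq_some G hc]
        exact sum_hopProb_le G c t x
    _ = _ := by
        rw [ENNReal.tsum_geometric, ENNReal.ofReal_sub _ (Real.sqrt_nonneg c), ENNReal.ofReal_one]

end Walk

/-! ### The backward walk -/

@[simp] theorem Timed.bind_val {α β : Type u} (x : Timed α) (f : α → Timed β) :
    (x >>= f).val = (f x.val).val := rfl

@[simp] theorem Timed.bind_cost {α β : Type u} (x : Timed α) (f : α → Timed β) :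
    (x >>= f).cost = x.cost + (f x.val).cost := rfl

@[simp] theorem Timed.pure_val {α : Type u} (a : α) : (pure a : Timed α).val = a := rfl

@[simp] theorem Timed.pure_cost {α : Type u} (a : α) : (pure a : Timed α).cost = 0 := rfl

@[simp] theorem tick_cost (k : ℕ∞) : (tick k : Timed PUnit.{u + 1}).cost = k := rfl

/-- Amortized cost of a loop. -/
theorem forEach_amortized {α : Type*} {σ : Type u} (K : ENNReal) (f : α → σ → Timed σ)
    (Φ : σ → ENNReal) (h : α → ENNReal) (l : List α)
    (hf : ∀ a ∈ l, ∀ s, K * ((f a s).cost : ENNReal) + Φ (f a s).val ≤ Φ s + h a) (s : σ) :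
    K * ((forEach f l s).cost : ENNReal) + Φ (forEach f l s).val ≤ Φ s + (l.map h).sum := by
  induction l generalizing s with
  | nil => simp [forEach]
  | cons a l ih =>
    have h1 := ih (fun b hb => hf b (List.mem_cons_of_mem _ hb)) (f a s).val
    have h2 := hf a List.mem_cons_self s
    simp only [forEach, Timed.bind_cost, Timed.bind_val, ENat.toENNReal_add, mul_add,
      List.map_cons, List.sum_cons]
    calc _ ≤ K * ((f a s).cost : ENNReal) + (Φ (f a s).val + (l.map h).sum) := by
            rw [add_assoc]; gcongr
      _ ≤ _ := by rw [← add_assoc, ← add_assoc]; gcongr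

theorem forEach_val_apply {α ι : Type*} {M : Type*} [AddCommMonoid M]
    (f : α → (ι →₀ M) → Timed (ι →₀ M)) (g : α → ι → M)
    (hf : ∀ a m v, (f a m).val v = m v + g a v) (l : List α) (m : ι →₀ M) (v : ι) :
    (forEach f l m).val v = m v + (l.map fun a => g a v).sum := by
  induction l generalizing m with
  | nil => simp [forEach]
  | cons a l ih => simp [forEach, ih, hf, add_assoc]

variable {V : Type u}

open scoped Classical in
theorem scan_val (P : V → Prop) (a : V → ℝ) (l : List V) (m : V →₀ ℝ) :
    (scan P a l m).val = (m + ((l.takeWhile fun y => decide (P y)).map fun y =>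
      Finsupp.single y (a y)).sum, l.dropWhile fun y => decide (P y)) := by
  induction l generalizing m with
  | nil => simp [scan]
  | cons y l ih => by_cases h : P y <;> simp [scan, h, ih, add_assoc]

open scoped Classical in
theorem scan_cost_le (P : V → Prop) (a : V → ℝ) (l : List V) (m : V →₀ ℝ) :
    (scan P a l m).cost ≤ (l.takeWhile fun y => decide (P y)).length + 1 := by
  induction l generalizing m with
  | nil => simp [scan]
  | cons y l ih =>
    by_cases h : P y
    · simp only [scan, h, Timed.bind_cost, tick_cost, if_true, decide_true, List.takeWhile_cons,
        List.length_cons, Nat.cast_add, Nat.cast_one]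
      calc _ ≤ 1 + (((l.takeWhile fun y => decide (P y)).length : ℕ∞) + 1) := by gcongr; exact ih _
        _ = _ := by ring
    · simp [scan, h]

/-- This is where the sorting of the out-adjacency lists enters: a scan that stops at the first
failure still reaches every neighbour below the threshold. -/
theorem takeWhile_eq_filter_of_pairwise {α : Type*} (d : α → ℝ) (T : ℝ) (l : List α)
    (hl : l.Pairwise fun y z => d y ≤ d z) :
    (l.takeWhile fun y => decide (d y ≤ T)) = l.filter fun y => decide (d y ≤ T) := by
  induction l with
  | nil => rfl
  | cons y l ih =>
    rw [List.pairwise_cons] at hl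
    by_cases h : d y ≤ T
    · simp [h, ih hl.2]
    · simp only [List.takeWhile_cons, h, decide_false, List.filter_cons, Bool.false_eq_true,
        if_false]
      symm
      rw [List.filter_eq_nil_iff]
      intro z hz h'
      exact h ((hl.1 z hz).trans (of_decide_eq_true h'))

theorem dropWhile_eq_filter_of_pairwise {α : Type*} (d : α → ℝ) (T : ℝ) (l : List α)
    (hl : l.Pairwise fun y z => d y ≤ d z) :
    (l.dropWhile fun y => decide (d y ≤ T)) = l.filter fun y => decide (¬ d y ≤ T) := by
  induction l with
  | nil => rfl
  | cons y l ih =>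
    have hl' := hl
    rw [List.pairwise_cons] at hl
    by_cases h : d y ≤ T
    · simp [h, ih hl.2]
    · simp only [List.dropWhile_cons, h, decide_false, Bool.false_eq_true, if_false]
      symm
      rw [List.filter_eq_self]
      intro z hz
      rcases List.mem_cons.1 hz with rfl | hz
      · simpa using h
      · simpa using (not_le.1 h).trans_le (hl.1 z hz)

open scoped Classical in
theorem sum_map_single_apply (a : V → ℝ) {l : List V} (hl : l.Nodup) (v : V) :
    (l.map fun y => Finsupp.single y (a y)).sum v = if v ∈ l then a v else 0 := by
  induction l with
  | nil => simp
  | cons y l ih =>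
    rw [List.nodup_cons] at hl
    have ih := ih hl.2
    simp only [List.map_cons, List.sum_cons, Finsupp.add_apply, ih, Finsupp.single_apply]
    by_cases h : y = v
    · subst h; simp [hl.1]
    · simp [h, Ne.symm h]

variable [Fintype V]

theorem mem_outList {G : Digraph V} {x y : V} : y ∈ outList G x ↔ G.Adj x y := by
  simp [outList]

theorem nodup_outList (G : Digraph V) (x : V) : (outList G x).Nodup :=
  (List.mergeSort_perm _ _).nodup_iff.2 (Finset.nodup_toList _)

theorem pairwise_outList (G : Digraph V) (x : V) :
    (outList G x).Pairwise fun y z => (inDeg G y : ℝ) ≤ inDeg G z := by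
  refine (List.pairwise_mergeSort (le := fun y z => decide (inDeg G y ≤ inDeg G z)) ?_ ?_ _).imp ?_
  · intro a b c h1 h2
    simp only [decide_eq_true_eq] at *
    exact h1.trans h2
  · intro a b
    simp [le_total]
  · intro a b h
    simpa using h

open scoped Classical in
/-- The amount that processing node `x` with estimate `a` adds to the next estimate of `v`. -/
def pushIncr (G : Digraph V) (c : ℝ) (b : unitInterval × unitInterval) (x : V) (a : ℝ) (v : V) :
    ℝ :=
  if (b.1 : ℝ) < √c ∧ G.Adj x v then
    if (inDeg G v : ℝ) ≤ a / (1 - √c) then a / inDeg G v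
    else if (inDeg G v : ℝ) ≤ a / (b.2 * (1 - √c)) then 1 - √c else 0
  else 0

section push
open scoped Classical

/-- The out-neighbours that are served by the first and by the second scan. -/
def firstScan (G : Digraph V) (c : ℝ) (x : V) (a : ℝ) : List V :=
  (outList G x).filter fun y => decide ((inDeg G y : ℝ) ≤ a / (1 - √c))

/-- The out-neighbours that are served by the second scan. -/
def secondScan (G : Digraph V) (c : ℝ) (r : unitInterval) (x : V) (a : ℝ) : List V :=
  ((outList G x).filter fun y => decide (¬ (inDeg G y : ℝ) ≤ a / (1 - √c))).filter
    fun y => decide ((inDeg G y : ℝ) ≤ a / (r * (1 - √c)))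

theorem push_of_lt (G : Digraph V) {c : ℝ} {r₀ : unitInterval} (hr : (r₀ : ℝ) < √c)
    (r : unitInterval) (x : V) (a : ℝ) (m : V →₀ ℝ) :
    (push G c r₀ r x a m).val = m +
      ((firstScan G c x a).map fun y => Finsupp.single y (a / inDeg G y)).sum +
      ((secondScan G c r x a).map fun y => Finsupp.single y (1 - √c)).sum ∧
    (push G c r₀ r x a m).cost ≤
      ((firstScan G c x a).length + (secondScan G c r x a).length : ℕ) + 3 := by
  have h1 := takeWhile_eq_filter_of_pairwise (fun y => (inDeg G y : ℝ)) (a / (1 - √c)) _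
    (pairwise_outList G x)
  have h2 := dropWhile_eq_filter_of_pairwise (fun y => (inDeg G y : ℝ)) (a / (1 - √c)) _
    (pairwise_outList G x)
  have h3 := takeWhile_eq_filter_of_pairwise (fun y => (inDeg G y : ℝ)) (a / (r * (1 - √c))) _
    ((pairwise_outList G x).filter fun y => decide (¬ (inDeg G y : ℝ) ≤ a / (1 - √c)))
  constructor
  · simp only [push, hr, if_true, Timed.bind_val, Timed.pure_val, scan_val, h1, h2, h3, firstScan,
      secondScan]
  · simp only [push, hr, if_true, Timed.bind_cost, Timed.pure_cost, tick_cost, scan_val, h2,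
      add_zero]
    have c1 := scan_cost_le (fun y => (inDeg G y : ℝ) ≤ a / (1 - √c)) (fun y => a / inDeg G y)
      (outList G x) m
    have c2 := fun m' => scan_cost_le (fun y => (inDeg G y : ℝ) ≤ a / (r * (1 - √c)))
      (fun _ => 1 - √c)
      ((outList G x).filter fun y => decide (¬ (inDeg G y : ℝ) ≤ a / (1 - √c))) m'
    rw [h1] at c1
    rw [h3] at c2
    -- The overhead 3 is the operation of the push itself plus, for each of the two scans, the node
    -- or list end that stops it.
    calc _ ≤ 1 + (((firstScan G c x a).length + 1 : ℕ∞) + ((secondScan G c r x a).length + 1)) := by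
          gcongr
          · exact c1
          · exact c2 _
      _ = _ := by push_cast; ring

theorem nodup_firstScan (G : Digraph V) (c : ℝ) (x : V) (a : ℝ) : (firstScan G c x a).Nodup :=
  (nodup_outList G x).filter _

theorem nodup_secondScan (G : Digraph V) (c : ℝ) (r : unitInterval) (x : V) (a : ℝ) :
    (secondScan G c r x a).Nodup :=
  ((nodup_outList G x).filter _).filter _

theorem mem_firstScan {G : Digraph V} {c : ℝ} {x : V} {a : ℝ} {v : V} :
    v ∈ firstScan G c x a ↔ G.Adj x v ∧ (inDeg G v : ℝ) ≤ a / (1 - √c) := by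
  simp [firstScan, mem_outList]

theorem mem_secondScan {G : Digraph V} {c : ℝ} {r : unitInterval} {x : V} {a : ℝ} {v : V} :
    v ∈ secondScan G c r x a ↔ G.Adj x v ∧ ¬ (inDeg G v : ℝ) ≤ a / (1 - √c) ∧
      (inDeg G v : ℝ) ≤ a / (r * (1 - √c)) := by
  simp only [secondScan, List.mem_filter, mem_outList, decide_eq_true_eq]
  tauto

theorem push_val_apply (G : Digraph V) (c : ℝ) (b : unitInterval × unitInterval) (x : V) (a : ℝ)
    (m : V →₀ ℝ) (v : V) :
    (push G c b.1 b.2 x a m).val v = m v + pushIncr G c b x a v := by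
  by_cases hr : (b.1 : ℝ) < √c
  · rw [(push_of_lt G hr b.2 x a m).1, Finsupp.add_apply, Finsupp.add_apply,
      sum_map_single_apply _ (nodup_firstScan G c x a),
      sum_map_single_apply (fun _ => 1 - √c) (nodup_secondScan G c b.2 x a)]
    simp only [mem_firstScan, mem_secondScan, pushIncr, hr, true_and]
    by_cases h1 : G.Adj x v <;> by_cases h2 : (inDeg G v : ℝ) ≤ a / (1 - √c) <;> simp [h1, h2]
  · simp [push, pushIncr, hr]

end push

/-- The condition of the first scan says exactly that a/d_in(v) ≥ 1 - √c, and the second scan adds 1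
- √c. This lower bound lets estimate mass pay for running time. -/
theorem pushIncr_eq_zero_or (G : Digraph V) {c : ℝ} (hc : c < 1) (b : unitInterval × unitInterval)
    (x : V) (a : ℝ) (v : V) : pushIncr G c b x a v = 0 ∨ 1 - √c ≤ pushIncr G c b x a v := by
  have hq := one_sub_sqrt_pos hc
  unfold pushIncr
  split_ifs with h1 h2 h3
  · right
    have hd : (0 : ℝ) < inDeg G v := by exact_mod_cast inDeg_pos h1.2
    rw [le_div_iff₀ hd, mul_comm]
    exact (le_div_iff₀ hq).1 h2
  · exact Or.inr le_rfl
  · exact Or.inl rfl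
  · exact Or.inl rfl

theorem pushIncr_nonneg (G : Digraph V) {c : ℝ} (hc : c < 1) (b : unitInterval × unitInterval)
    (x : V) (a : ℝ) (v : V) : 0 ≤ pushIncr G c b x a v := by
  have hq := one_sub_sqrt_pos hc
  rcases pushIncr_eq_zero_or G hc b x a v with h | h
  · exact h.ge
  · exact hq.le.trans h

theorem pushIncr_zero (G : Digraph V) (c : ℝ) (b : unitInterval × unitInterval)
    (x : V) (v : V) : pushIncr G c b x 0 v = 0 := by
  unfold pushIncr
  split_ifs with h1 h2 h3
  · simp
  · have hd : (0 : ℝ) < inDeg G v := by exact_mod_cast inDeg_pos h1.2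
    rw [zero_div] at h3
    exact absurd h3 (not_le.2 hd)
  · rfl
  · rfl

/-- Every node that is served by a scan gets an increment of at least `1 - √c`; this pays for the
scans. -/
theorem push_cost_le (G : Digraph V) {c : ℝ} (hc : c < 1) (b : unitInterval × unitInterval)
    (x : V) {a : ℝ} (ha : 1 - √c ≤ a) (m : V →₀ ℝ) :
    ENNReal.ofReal (1 - √c) * ((push G c b.1 b.2 x a m).cost : ENNReal) ≤
      3 * ENNReal.ofReal a + ∑ v, ENNReal.ofReal (pushIncr G c b x a v) := by
  classical
  have hq := one_sub_sqrt_pos hc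
  by_cases hr : (b.1 : ℝ) < √c
  · set l := firstScan G c x a ++ secondScan G c b.2 x a with hl
    have hcost : ((push G c b.1 b.2 x a m).cost : ENNReal) ≤ l.length + 3 := by
      have := ENat.toENNReal_le.2 (push_of_lt G hr b.2 x a m).2
      simpa [hl] using this
    have hnd : l.Nodup := by
      refine List.nodup_append'.2 ⟨nodup_firstScan G c x a, nodup_secondScan G c b.2 x a, ?_⟩
      intro v h1 h2
      exact (mem_secondScan.1 h2).2.1 (mem_firstScan.1 h1).2
    have hinc : ∀ v ∈ l, 1 - √c ≤ pushIncr G c b x a v := by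
      intro v hv
      rcases List.mem_append.1 hv with h | h
      · rw [mem_firstScan] at h
        have hd : (0 : ℝ) < inDeg G v := by exact_mod_cast inDeg_pos h.1
        rw [pushIncr, if_pos ⟨hr, h.1⟩, if_pos h.2, le_div_iff₀ hd, mul_comm]
        exact (le_div_iff₀ hq).1 h.2
      · rw [mem_secondScan] at h
        rw [pushIncr, if_pos ⟨hr, h.1⟩, if_neg h.2.1, if_pos h.2.2]
    calc _ ≤ ENNReal.ofReal (1 - √c) * (l.length + 3) := by gcongr
      -- The overhead is charged to the estimate of `x` itself, the served nodes to their own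
      -- increments.
      _ = 3 * ENNReal.ofReal (1 - √c) + ∑ v ∈ l.toFinset, ENNReal.ofReal (1 - √c) := by
          rw [Finset.sum_const, List.toFinset_card_of_nodup hnd, nsmul_eq_mul]; ring
      _ ≤ 3 * ENNReal.ofReal a + ∑ v ∈ l.toFinset, ENNReal.ofReal (pushIncr G c b x a v) := by
          gcongr with v hv
          exact hinc v (List.mem_toFinset.1 hv)
      _ ≤ _ := by
          gcongr
          exact Finset.subset_univ _
  · have h : (push G c b.1 b.2 x a m).cost = 1 := by simp [push, hr]
    rw [h, ENat.toENNReal_one, mul_one]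
    calc ENNReal.ofReal (1 - √c) ≤ 1 * ENNReal.ofReal a := by
          rw [one_mul]; exact ENNReal.ofReal_le_ofReal ha
      _ ≤ 3 * ENNReal.ofReal a := by gcongr; norm_num
      _ ≤ _ := le_self_add

/-- The estimate of the `i`-hop reverse personalized PageRank from `v` to `w`. -/
def estimate (G : Digraph V) (c : ℝ) (w : V) (β : BackTape V) (i : ℕ) (v : V) : ℝ :=
  (backwardWalk G c w β i).val v

theorem estimate_zero (G : Digraph V) (c : ℝ) (w : V) (β : BackTape V) (v : V) [Decidable (w = v)] :
    estimate G c w β 0 v = if w = v then 1 - √c else 0 := by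
  simp only [estimate, backwardWalk, Timed.bind_val, Timed.pure_val, Finsupp.single_apply]

/-- The loop over stored entries becomes a sum over all nodes, because a node with estimate 0 pushes
nothing. -/
theorem estimate_succ (G : Digraph V) (c : ℝ) (w : V) (β : BackTape V) (i : ℕ) (v : V) :
    estimate G c w β (i + 1) v = ∑ x, pushIncr G c (β i x) x (estimate G c w β i x) v := by
  simp only [estimate, backwardWalk, Timed.bind_val]
  rw [forEach_val_apply _ (fun x v => pushIncr G c (β i x) x ((backwardWalk G c w β i).val x) v)
    (fun x m v => push_val_apply G c (β i x) x _ m v)]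
  rw [Finsupp.zero_apply, zero_add, Finset.sum_map_toList]
  refine Finset.sum_subset (Finset.subset_univ _) fun x _ hx => ?_
  rw [Finsupp.notMem_support_iff.1 hx, pushIncr_zero]

theorem estimate_eq_zero_or (G : Digraph V) {c : ℝ} (hc : c < 1) (w : V) (β : BackTape V) (i : ℕ)
    (v : V) : estimate G c w β i v = 0 ∨ 1 - √c ≤ estimate G c w β i v := by
  classical
  cases i with
  | zero => rw [estimate_zero]; split_ifs <;> simp
  | succ i =>
    rw [estimate_succ]
    by_cases h : ∃ x, pushIncr G c (β i x) x (estimate G c w β i x) v ≠ 0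
    · obtain ⟨x, hx⟩ := h
      right
      exact ((pushIncr_eq_zero_or G hc _ _ _ _).resolve_left hx).trans
        (Finset.single_le_sum (f := fun x => pushIncr G c (β i x) x (estimate G c w β i x) v)
          (fun x _ => pushIncr_nonneg G hc _ _ _ _) (Finset.mem_univ x))
    · push Not at h
      left
      exact Finset.sum_eq_zero fun x _ => h x

theorem estimate_nonneg (G : Digraph V) {c : ℝ} (hc : c < 1) (w : V) (β : BackTape V) (i : ℕ)
    (v : V) : 0 ≤ estimate G c w β i v := by
  have hq := one_sub_sqrt_pos hc
  rcases estimate_eq_zero_or G hc w β i v with h | h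
  · exact h.ge
  · exact hq.le.trans h

/-- The total of the estimates of level `i`. -/
def totalEstimate (G : Digraph V) (c : ℝ) (w : V) (β : BackTape V) (i : ℕ) : ENNReal :=
  ∑ v, ENNReal.ofReal (estimate G c w β i v)

theorem card_support_backwardWalk_le (G : Digraph V) {c : ℝ} (hc : c < 1) (w : V) (β : BackTape V)
    (i : ℕ) : ENNReal.ofReal (1 - √c) * ((backwardWalk G c w β i).val.support.card : ENNReal) ≤
      totalEstimate G c w β i := by
  rw [mul_comm, ← nsmul_eq_mul, ← Finset.sum_const]
  refine (Finset.sum_le_sum fun v hv => ?_).trans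
    (Finset.sum_le_sum_of_subset (Finset.subset_univ _))
  exact ENNReal.ofReal_le_ofReal
    ((estimate_eq_zero_or G hc w β i v).resolve_left (Finsupp.mem_support_iff.1 hv))

/-- Each unit of estimate carries a charge of 4: 1 for the scan step that created it and 3 for the
overhead of processing its node later. On the last level `i` the 3 is still unspent, which is why it
appears on the left; it strengthens the induction and later pays for using the result. -/
theorem backwardWalk_cost_le (G : Digraph V) {c : ℝ} (hc : c < 1) (w : V) (β : BackTape V)
    (i : ℕ) :
    ENNReal.ofReal (1 - √c) * ((backwardWalk G c w β i).cost : ENNReal) +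
        3 * totalEstimate G c w β i ≤
      ENNReal.ofReal (1 - √c) * (i + 1 : ℕ) +
        4 * ∑ k ∈ Finset.range (i + 1), totalEstimate G c w β k := by
  set K := ENNReal.ofReal (1 - √c)
  induction i with
  | zero =>
    simp only [backwardWalk, Timed.bind_cost, tick_cost, Timed.pure_cost, add_zero,
      ENat.toENNReal_one, zero_add, Finset.range_one, Finset.sum_singleton, Nat.cast_one]
    gcongr
    norm_num
  | succ i ih =>
    have hloop := forEach_amortized K
      (fun x m => push G c (β i x).1 (β i x).2 x ((backwardWalk G c w β i).val x) m) (fun _ => 0)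
      (fun x => 3 * ENNReal.ofReal (estimate G c w β i x) +
        ∑ v, ENNReal.ofReal (pushIncr G c (β i x) x (estimate G c w β i x) v))
      (backwardWalk G c w β i).val.support.toList (fun x hx m => by
        rw [add_zero, zero_add]
        refine push_cost_le G hc (β i x) x ?_ m
        exact (estimate_eq_zero_or G hc w β i x).resolve_left
          (Finsupp.mem_support_iff.1 (Finset.mem_toList.1 hx))) 0
    rw [Finset.sum_map_toList, add_zero, zero_add] at hloop
    have hsum : ∑ x ∈ (backwardWalk G c w β i).val.support,
        (3 * ENNReal.ofReal (estimate G c w β i x) +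
          ∑ v, ENNReal.ofReal (pushIncr G c (β i x) x (estimate G c w β i x) v)) ≤
        3 * totalEstimate G c w β i + totalEstimate G c w β (i + 1) := by
      refine (Finset.sum_le_sum_of_subset (Finset.subset_univ _)).trans ?_
      rw [Finset.sum_add_distrib, ← Finset.mul_sum, Finset.sum_comm]
      refine add_le_add le_rfl (Finset.sum_le_sum fun v _ => ?_)
      rw [estimate_succ, ENNReal.ofReal_sum_of_nonneg fun x _ => pushIncr_nonneg G hc _ _ _ _]
    have hloop := hloop.trans hsum
    simp only [backwardWalk, Timed.bind_cost, tick_cost, ENat.toENNReal_add, ENat.toENNReal_one]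
    rw [Finset.sum_range_succ]
    calc _ ≤ K * ((backwardWalk G c w β i).cost : ENNReal) + K +
          (3 * totalEstimate G c w β i + totalEstimate G c w β (i + 1)) +
          3 * totalEstimate G c w β (i + 1) := by
            rw [mul_add, mul_add, mul_one, ← add_assoc]
            gcongr
      _ = (K * ((backwardWalk G c w β i).cost : ENNReal) + 3 * totalEstimate G c w β i) + K +
          4 * totalEstimate G c w β (i + 1) := by ring
      _ ≤ _ := by
          grw [ih]
          push_cast
          apply le_of_eq
          ring

/-! ### Expectation of the backward estimates -/

theorem measurable_pushIncr (G : Digraph V) (c : ℝ) (x v : V) :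
    Measurable fun p : ℝ × (unitInterval × unitInterval) => pushIncr G c p.2 x p.1 v := by
  unfold pushIncr
  refine Measurable.ite ?_ (Measurable.ite ?_ ?_ (Measurable.ite ?_ ?_ ?_)) ?_
  · have h : Measurable fun p : ℝ × (unitInterval × unitInterval) => (p.2.1 : ℝ) := by fun_prop
    exact (measurableSet_lt h measurable_const).inter (MeasurableSet.const _)
  · exact measurableSet_le measurable_const (by fun_prop)
  · fun_prop
  · exact measurableSet_le measurable_const (by fun_prop)
  · fun_prop
  · fun_prop
  · fun_prop

theorem measurable_estimate (G : Digraph V) (c : ℝ) (w : V) (i : ℕ) (v : V) :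
    Measurable fun β => estimate G c w β i v := by
  classical
  induction i generalizing v with
  | zero => simp only [estimate_zero]; exact measurable_const
  | succ i ih =>
    simp only [estimate_succ]
    refine Finset.measurable_sum _ fun x _ => ?_
    exact (measurable_pushIncr G c x v).comp ((ih x).prodMk
      ((measurable_pi_apply x).comp (measurable_pi_apply i)))

theorem estimate_congr (G : Digraph V) (c : ℝ) (w : V) {β β' : BackTape V} {i : ℕ}
    (h : ∀ k < i, β k = β' k) (v : V) : estimate G c w β i v = estimate G c w β' i v := by
  classical
  induction i generalizing v with
  | zero => simp only [estimate_zero]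
  | succ i ih =>
    simp only [estimate_succ]
    refine Finset.sum_congr rfl fun x _ => ?_
    rw [ih (fun k hk => h k (hk.trans i.lt_succ_self)) x, h i i.lt_succ_self]

/-- In both regimes the mean is √c·a/d: with probability √c the increment is a/d, or else it is 1 -
√c with probability √c·a/(d(1 - √c)). Only the upper bound is needed. -/
theorem lintegral_pushIncr_le (G : Digraph V) {c : ℝ} (hc : c < 1) (x v : V) {a : ℝ}
    (ha : 0 ≤ a) :
    ∫⁻ b, ENNReal.ofReal (pushIncr G c b x a v) ∂randPair ≤
      stepProb G c v x * ENNReal.ofReal a := by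
  have hq := one_sub_sqrt_pos hc
  have hq0 : 0 ≤ √c := Real.sqrt_nonneg c
  have hq1 : √c ≤ 1 := by linarith
  by_cases hadj : G.Adj x v
  swap
  · simp [pushIncr, stepProb, hadj]
  have hd : (0 : ℝ) < inDeg G v := by exact_mod_cast inDeg_pos hadj
  have hstep : stepProb G c v x * ENNReal.ofReal a = ENNReal.ofReal (√c * (a / inDeg G v)) := by
    rw [stepProb, if_pos hadj, ENNReal.ofReal_mul hq0, ENNReal.ofReal_div_of_pos hd,
      ENNReal.ofReal_natCast, ENNReal.div_eq_inv_mul]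
    ring
  -- In either regime the increment is dominated by a constant `C` on a product event `s`, whose
  -- measure factors over the two random numbers.
  obtain ⟨s, C, hC, hs, hle, hfin⟩ : ∃ (s : Set (unitInterval × unitInterval)) (C : ℝ), 0 ≤ C ∧
      MeasurableSet s ∧
      (∀ b, ENNReal.ofReal (pushIncr G c b x a v) ≤ ENNReal.ofReal C * s.indicator 1 b) ∧
      ENNReal.ofReal C * randPair s ≤ ENNReal.ofReal (√c * (a / inDeg G v)) := by
    have hr0 : MeasurableSet {r : unitInterval | (r : ℝ) < √c} :=
      measurableSet_lt measurable_subtype_coe measurable_const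
    by_cases h1 : (inDeg G v : ℝ) ≤ a / (1 - √c)
    · refine ⟨{r : unitInterval | (r : ℝ) < √c} ×ˢ Set.univ, a / inDeg G v, by positivity,
        hr0.prod MeasurableSet.univ, fun b => ?_, ?_⟩
      · by_cases hb : (b.1 : ℝ) < √c
        · simp [pushIncr, hb, hadj, h1]
        · simp [pushIncr, hb]
      · rw [randPair, Measure.prod_prod, measure_univ, mul_one, volume_coe_lt hq1,
          ← ENNReal.ofReal_mul (by positivity), mul_comm]
    · refine ⟨{r : unitInterval | (r : ℝ) < √c} ×ˢ
        {r : unitInterval | (r : ℝ) ≤ a / (inDeg G v * (1 - √c))}, 1 - √c, hq.le,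
        hr0.prod (measurableSet_le measurable_subtype_coe measurable_const), fun b => ?_, ?_⟩
      · by_cases hb : (b.1 : ℝ) < √c ∧ (inDeg G v : ℝ) ≤ a / (b.2 * (1 - √c))
        · have hpos : (0 : ℝ) < b.2 := by
            refine lt_of_le_of_ne b.2.2.1 fun h => ?_
            have := hb.2
            rw [← h, zero_mul, div_zero] at this
            linarith
          have hmem : (b.2 : ℝ) ≤ a / (inDeg G v * (1 - √c)) := by
            rw [le_div_iff₀ (by positivity)]
            have := (le_div_iff₀ (by positivity)).1 hb.2
            linarith
          simp [pushIncr, hb.1, hb.2, hadj, h1, hmem]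
        · have : pushIncr G c b x a v = 0 := by
            simp only [pushIncr, hadj, and_true, h1, if_false]
            split_ifs <;> tauto
          simp [this]
      · rw [randPair, Measure.prod_prod, volume_coe_lt hq1]
        calc _ ≤ ENNReal.ofReal (1 - √c) *
              (ENNReal.ofReal √c * ENNReal.ofReal (a / (inDeg G v * (1 - √c)))) := by
                gcongr; exact volume_coe_le_le _
          _ = _ := by
            rw [← ENNReal.ofReal_mul hq0, ← ENNReal.ofReal_mul hq.le]
            congr 1
            field_simp
  calc _ ≤ ∫⁻ b, ENNReal.ofReal C * s.indicator 1 b ∂randPair := lintegral_mono hle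
    _ ≤ _ := by
      rw [lintegral_const_mul _ (measurable_one.indicator hs), lintegral_indicator_one hs, hstep]
      exact hfin

/-- The numbers drawn on level `i` are independent of the estimates there, so the one-step mean can
be iterated along the first-step recursion of `hopProb`. The factor 1 - √c is the initial estimate.
-/
theorem lintegral_estimate_le (G : Digraph V) {c : ℝ} (hc : c < 1) (w : V) (i : ℕ) (v : V) :
    ∫⁻ β, ENNReal.ofReal (estimate G c w β i v) ∂backMeasure V ≤
      hopProb G c i v w * ENNReal.ofReal (1 - √c) := by
  classical
  induction i generalizing v with
  | zero =>
    simp only [estimate_zero, lintegral_const, measure_univ, mul_one, hopProb]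
    by_cases h : w = v
    · simp [h]
    · simp [h, Ne.symm h]
  | succ i ih =>
    have hm : ∀ x, Measurable fun β : BackTape V =>
        ENNReal.ofReal (pushIncr G c (β i x) x (estimate G c w β i x) v) := fun x =>
      ((measurable_pushIncr G c x v).comp ((measurable_estimate G c w i x).prodMk
        ((measurable_pi_apply x).comp (measurable_pi_apply i)))).ennreal_ofReal
    simp only [estimate_succ]
    simp_rw [ENNReal.ofReal_sum_of_nonneg fun x _ => pushIncr_nonneg G hc _ x _ v]
    rw [lintegral_finsetSum _ fun x _ => hm x, hopProb_succ, Finset.sum_mul]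
    refine Finset.sum_le_sum fun x _ => ?_
    rw [backMeasure, lintegral_infinitePi_adapted _ i (measurable_estimate G c w i x)
      (fun β β' h => estimate_congr G c w h x)
      (F := fun a b => ENNReal.ofReal (pushIncr G c (b x) x a v))
      (((measurable_pushIncr G c x v).comp (measurable_fst.prodMk
        ((measurable_pi_apply x).comp measurable_snd))).ennreal_ofReal), ← backMeasure]
    calc _ ≤ ∫⁻ β, stepProb G c v x * ENNReal.ofReal (estimate G c w β i x) ∂backMeasure V := by
          refine lintegral_mono fun β => ?_
          have hmp := measurePreserving_eval (fun _ : V => randPair) x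
          have := hmp.lintegral_comp (f := fun b =>
            ENNReal.ofReal (pushIncr G c b x (estimate G c w β i x) v))
            ((measurable_pushIncr G c x v).comp
              (measurable_const.prodMk measurable_id)).ennreal_ofReal
          simp only [Function.eval] at this
          rw [this]
          exact lintegral_pushIncr_le G hc x v (estimate_nonneg G hc w β i x)
      _ ≤ _ := by
          rw [lintegral_const_mul _ (measurable_estimate G c w i x).ennreal_ofReal, mul_assoc]
          gcongr
          exact ih x

theorem measurable_totalEstimate (G : Digraph V) (c : ℝ) (w : V) (i : ℕ) :
    Measurable fun β => totalEstimate G c w β i :=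
  Finset.measurable_sum _ fun v _ => (measurable_estimate G c w i v).ennreal_ofReal

theorem lintegral_totalEstimate_le (G : Digraph V) {c : ℝ} (hc : c < 1) (w : V) (i : ℕ) :
    ∫⁻ β, totalEstimate G c w β i ∂backMeasure V ≤ ∑ v, endProb G c v w i := by
  simp only [totalEstimate]
  rw [lintegral_finsetSum _ fun v _ => (measurable_estimate G c w i v).ennreal_ofReal]
  refine Finset.sum_le_sum fun v _ => (lintegral_estimate_le G hc w i v).trans ?_
  rw [mul_comm]
  exact mul_hopProb_le_endProb G hc.le v w i

theorem rMax_pos {c ε : ℝ} (hc : c < 1) (hε : 0 < ε) : 0 < rMax c ε := by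
  have := one_sub_sqrt_pos hc
  unfold rMax c₁
  positivity

/-! ### The size of the index -/

theorem residue_nonneg (G : Digraph V) (c ε : ℝ) (w : V) (ℓ : ℕ) (v : V) :
    0 ≤ residue G c ε w ℓ v := by
  cases ℓ with
  | zero => rw [residue]; split_ifs <;> simp
  | succ ℓ =>
    induction ℓ generalizing v with
    | zero =>
      rw [residue]
      refine Finset.sum_nonneg fun x _ => ?_
      have : 0 ≤ residue G c ε w 0 x := by rw [residue]; split_ifs <;> simp
      split_ifs <;> positivity
    | succ ℓ ih =>
      rw [residue]
      refine Finset.sum_nonneg fun x _ => ?_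
      have := ih x
      split_ifs <;> positivity

/-- Without a threshold the residues would satisfy the recursion of `hopProb`; discarding small
residues only lowers them. -/
theorem ofReal_residue_le (G : Digraph V) (c ε : ℝ) (w : V) (ℓ : ℕ) (v : V) :
    ENNReal.ofReal (residue G c ε w ℓ v) ≤ hopProb G c ℓ v w := by
  induction ℓ generalizing v with
  | zero =>
    rw [residue, hopProb]
    split_ifs <;> simp
  | succ ℓ ih =>
    rw [residue, hopProb_succ, ENNReal.ofReal_sum_of_nonneg fun x _ => by
      have := residue_nonneg G c ε w ℓ x
      split_ifs <;> positivity]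
    refine Finset.sum_le_sum fun x _ => ?_
    split_ifs with h
    · have hd : (0 : ℝ) < inDeg G v := by exact_mod_cast inDeg_pos h.1
      rw [stepProb, if_pos h.1, ENNReal.ofReal_mul (Real.sqrt_nonneg c),
        ENNReal.ofReal_div_of_pos hd, ENNReal.ofReal_natCast, ENNReal.div_eq_inv_mul, ← mul_assoc]
      gcongr
      exact ih x
    · simp

/-- Every listed reserve exceeds r_max and is at most the probability of terminating at `w` after
`ℓ` steps, so the sum of these probabilities bounds the count. -/
theorem length_indexList_le (G : Digraph V) {c : ℝ} (hc : c < 1) (ε : ℝ) (w : V) (ℓ : ℕ) :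
    ((indexList G c ε w ℓ).length : ENNReal) * ENNReal.ofReal (rMax c ε) ≤
      ∑ v, endProb G c v w ℓ := by
  classical
  rw [indexList, List.length_map, Finset.length_toList, ← nsmul_eq_mul, ← Finset.sum_const]
  refine (Finset.sum_le_sum fun v hv => ?_).trans
    (Finset.sum_le_sum_of_subset (Finset.subset_univ _))
  have h := (Finset.mem_filter.1 hv).2
  refine (ENNReal.ofReal_le_ofReal h.le).trans (le_trans ?_ (mul_hopProb_le_endProb G hc.le v w ℓ))
  unfold reserve
  split_ifs
  · rw [ENNReal.ofReal_mul (one_sub_sqrt_pos hc).le]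
    gcongr
    exact ofReal_residue_le G c ε w ℓ v
  · simp

/-! ### The later stages of a query -/

/-- The cost that a unit of the estimate with key `k` causes in the index stage. -/
def indexWeight (G : Digraph V) (c ε : ℝ) (k : V × ℕ) : ENNReal :=
  2 * (indexList G c ε k.1 k.2).length * (ENNReal.ofReal (rMax c ε))⁻¹

/-- A bound for the cost of the stages that follow the sampling. -/
def potential (G : Digraph V) (c ε : ℝ) (s : QueryState V) : ENNReal :=
  2 * s.sB.support.card +
    (s.etaPi.support.card + ∑' k, ENNReal.ofReal (s.etaPi k) * indexWeight G c ε k)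

theorem card_support_add_single_le {ι : Type*} (m : ι →₀ ℝ) (k : ι) (b : ℝ) :
    ((m + Finsupp.single k b).support.card : ENNReal) ≤ m.support.card + 1 := by
  classical
  have h1 := Finset.card_le_card (Finsupp.support_add (g₁ := m) (g₂ := Finsupp.single k b))
  have h2 := Finset.card_union_le m.support (Finsupp.single k b).support
  have h3 := Finset.card_le_card (Finsupp.support_single_subset (a := k) (b := b))
  rw [Finset.card_singleton] at h3
  exact_mod_cast h1.trans (h2.trans (Nat.add_le_add_left h3 _))

omit [Fintype V] in
-- The stored entries split into fibres over `v`: one unit per entry pays for the selections,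
-- another for the loop's output, at most one new entry per fibre. The output size is included to
-- pay for the final merging in `query`.
theorem medianStage_cost_le (f : ℕ) (sB : ℕ × V →₀ ℝ) :
    ((medianStage f sB).cost : ENNReal) + (medianStage f sB).val.support.card ≤
      2 * sB.support.card := by
  classical
  have h := forEach_amortized 1
    (fun v m => do
      tick ({i | sB (i, v) ≠ 0} : Set ℕ).encard
      pure (m + Finsupp.single v (median ((List.range f).map fun i => sB (i, v)))))
    (fun m : V →₀ ℝ => (m.support.card : ENNReal))
    (fun v => ((({i | sB (i, v) ≠ 0} : Set ℕ).encard : ℕ∞) : ENNReal) + 1)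
    (sB.support.image Prod.snd).toList (fun v _ m => by
      simp only [Timed.bind_cost, Timed.bind_val, Timed.pure_cost, Timed.pure_val, tick_cost,
        add_zero, one_mul]
      grw [card_support_add_single_le m v _]
      apply le_of_eq
      ring) 0
  rw [one_mul, Finset.sum_map_toList, Finset.sum_add_distrib] at h
  simp only [Finsupp.support_zero, Finset.card_empty, Nat.cast_zero, zero_add] at h
  have h1 : ∑ v ∈ sB.support.image Prod.snd,
      ((({i | sB (i, v) ≠ 0} : Set ℕ).encard : ℕ∞) : ENNReal) ≤ sB.support.card := by
    rw [Finset.card_eq_sum_card_image Prod.snd sB.support]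
    push_cast
    refine Finset.sum_le_sum fun v _ => ?_
    have h2 : ({i | sB (i, v) ≠ 0} : Set ℕ) =
        (((sB.support.filter fun k => k.2 = v).image Prod.fst : Finset ℕ) : Set ℕ) := by
      ext i
      simp
    rw [h2, Set.encard_coe_eq_coe_finsetCard, ENat.toENNReal_coe]
    exact_mod_cast Finset.card_image_le
  have h3 : ∑ v ∈ sB.support.image Prod.snd, (1 : ENNReal) ≤ sB.support.card := by
    rw [Finset.sum_const, nsmul_eq_mul, mul_one]
    exact_mod_cast Finset.card_image_le
  refine h.trans ((add_le_add h1 h3).trans ?_)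
  rw [two_mul]

/-- A list is read only if its estimate exceeds r_max, so its length is at most length · estimate /
r_max, which is linear in the estimate and can be charged to the samples. The 2 in `indexWeight`
covers retrieving a tuple and the output entry it may create. -/
theorem indexStage_cost_le (G : Digraph V) {c ε : ℝ} (hc : c < 1) (hε : 0 < ε) (H : Finset V)
    (etaPi : V × ℕ →₀ ℝ) :
    ((indexStage G c ε H etaPi).cost : ENNReal) + (indexStage G c ε H etaPi).val.support.card ≤
      etaPi.support.card + ∑' k, ENNReal.ofReal (etaPi k) * indexWeight G c ε k := by
  classical
  have hr := ENNReal.ofReal_pos.2 (rMax_pos hc hε)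
  have h := forEach_amortized 1
    (fun (k : V × ℕ) (m : V →₀ ℝ) => do
      tick 1
      if ε / c₁ c < etaPi k ∧ k.1 ∈ H then
        forEach (fun (q : V × ℝ) m => do
            tick 1
            pure (m + Finsupp.single q.1 (etaPi k * q.2 / (1 - √c) ^ 2)))
          (indexList G c ε k.1 k.2) m
      else pure m)
    (fun m => (m.support.card : ENNReal))
    (fun k => 1 + ENNReal.ofReal (etaPi k) * indexWeight G c ε k)
    etaPi.support.toList (fun k _ m => by
      simp only [Timed.bind_cost, Timed.bind_val, tick_cost, ENat.toENNReal_add,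
        ENat.toENNReal_one, one_mul]
      split_ifs with hk
      · have h1 := forEach_amortized 1
          (fun (q : V × ℝ) (m : V →₀ ℝ) => do
            tick 1
            pure (m + Finsupp.single q.1 (etaPi k * q.2 / (1 - √c) ^ 2)))
          (fun m => (m.support.card : ENNReal)) (fun _ => 2) (indexList G c ε k.1 k.2)
          (fun q _ m => by
            simp only [Timed.bind_cost, Timed.bind_val, Timed.pure_cost, Timed.pure_val, tick_cost,
              add_zero, one_mul, ENat.toENNReal_one]
            grw [card_support_add_single_le m q.1 _]
            apply le_of_eq
            ring) m
        rw [List.map_const', List.sum_replicate, nsmul_eq_mul, one_mul] at h1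
        have h2 : ((indexList G c ε k.1 k.2).length : ENNReal) * 2 ≤
            ENNReal.ofReal (etaPi k) * indexWeight G c ε k := by
          have h3 : 1 ≤ ENNReal.ofReal (etaPi k) * (ENNReal.ofReal (rMax c ε))⁻¹ := by
            rw [← ENNReal.mul_inv_cancel hr.ne' ENNReal.ofReal_ne_top]
            gcongr
            exact hk.1.le
          calc _ ≤ ((indexList G c ε k.1 k.2).length : ENNReal) * 2 *
                (ENNReal.ofReal (etaPi k) * (ENNReal.ofReal (rMax c ε))⁻¹) :=
                le_mul_of_one_le_right' h3
            _ = _ := by rw [indexWeight]; ring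
        rw [add_assoc]
        refine (add_le_add le_rfl (h1.trans (add_le_add le_rfl h2))).trans (le_of_eq ?_)
        ring
      · simp only [Timed.pure_cost, Timed.pure_val, ENat.toENNReal_zero, add_zero]
        rw [add_comm]
        gcongr
        exact le_self_add) 0
  rw [one_mul, Finset.sum_map_toList, Finset.sum_add_distrib] at h
  simp only [Finsupp.support_zero, Finset.card_empty, Nat.cast_zero, zero_add] at h
  refine h.trans (add_le_add ?_ (ENNReal.sum_le_tsum _))
  simp

/-! ### One sample -/

/-- A bound for the cost of a backward walk and of the use of its result. -/
def backCost (G : Digraph V) (c : ℝ) (w : V) (ℓ : ℕ) (β : BackTape V) : ENNReal :=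
  (ℓ + 1 : ℕ) + 4 * (ENNReal.ofReal (1 - √c))⁻¹ *
    ∑ k ∈ Finset.range (ℓ + 1), totalEstimate G c w β k

/-- Each non-zero estimate needs 3 more units: one to add it to ŝ_B^i, and two of potential for the
entry it may create. -/
theorem backwardWalk_cost_add_le (G : Digraph V) {c : ℝ} (hc : c < 1) (w : V) (ℓ : ℕ)
    (β : BackTape V) :
    ((backwardWalk G c w β ℓ).cost : ENNReal) + 3 * (backwardWalk G c w β ℓ).val.support.card ≤
      backCost G c w ℓ β := by
  have hK := (ENNReal.ofReal_pos.2 (one_sub_sqrt_pos hc)).ne'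
  rw [← ENNReal.mul_le_mul_iff_right hK ENNReal.ofReal_ne_top]
  calc _ = ENNReal.ofReal (1 - √c) * ((backwardWalk G c w β ℓ).cost : ENNReal) +
        3 * (ENNReal.ofReal (1 - √c) * (backwardWalk G c w β ℓ).val.support.card) := by ring
    _ ≤ _ := by
      grw [card_support_backwardWalk_le G hc w β ℓ, backwardWalk_cost_le G hc w β ℓ]
      rw [backCost, mul_add, mul_assoc 4, mul_left_comm _ 4,
        ENNReal.mul_inv_cancel_left hK ENNReal.ofReal_ne_top]

/-- A bound for the amortized cost of a sample from `x`. -/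
def sampleCost (G : Digraph V) (c ε δ : ℝ) (x : V) (σ : SampleTape V) : ENNReal :=
  1 + walkCost G c x σ.1.1 + ∑ w, ∑' ℓ, {ρ | EndsAt (walk G c x ρ) w ℓ}.indicator 1 σ.1.1 *
    (2 * walkCost G c w σ.1.2.1 + walkCost G c w σ.1.2.2 +
      (2 + ENNReal.ofReal (1 / (numSamples V c ε δ : ℝ)) * indexWeight G c ε (w, ℓ)) +
      backCost G c w ℓ σ.2)

omit [Fintype V] in
theorem endPoint_eq_some {p : ℕ → Option V} {e : V × ℕ} (h : endPoint p = some e) :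
    EndsAt p e.1 e.2 := by
  unfold endPoint at h
  split_ifs at h with h'
  · cases h
    exact h'.choose_spec

theorem sampleWalk_val (G : Digraph V) (c : ℝ) (x : V) (ρ : WalkTape) :
    (sampleWalk G c x ρ).val = walk G c x ρ := rfl

theorem potential_add_single_le (G : Digraph V) (c ε : ℝ) (m : V × ℕ →₀ ℝ) (sB : ℕ × V →₀ ℝ)
    (k : V × ℕ) (b : ℝ) :
    potential G c ε ⟨m + Finsupp.single k b, sB⟩ ≤
      potential G c ε ⟨m, sB⟩ + (1 + ENNReal.ofReal b * indexWeight G c ε k) := by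
  classical
  have h1 : ∑' j, ENNReal.ofReal ((m + Finsupp.single k b) j) * indexWeight G c ε j ≤
      ∑' j, ENNReal.ofReal (m j) * indexWeight G c ε j +
        ENNReal.ofReal b * indexWeight G c ε k := by
    rw [← tsum_ite_eq k fun j => ENNReal.ofReal b * indexWeight G c ε j, ← ENNReal.tsum_add]
    refine ENNReal.tsum_le_tsum fun j => ?_
    rw [Finsupp.add_apply]
    by_cases h : j = k
    · subst h
      rw [if_pos rfl, Finsupp.single_eq_same, ← add_mul]
      gcongr
      exact ENNReal.ofReal_add_le
    · rw [if_neg h, Finsupp.single_eq_of_ne h, add_zero, add_zero]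
  simp only [potential]
  grw [h1, card_support_add_single_le m k b]
  apply le_of_eq
  ring

/-- `sampleCost` charges every branch as if both the index and the backward walk were used, so the
cases differ only in which nonnegative terms are dropped. -/
theorem sampleStep_amortized (G : Digraph V) {c : ℝ} (hc : c < 1) (ε δ : ℝ) (H : Finset V) (x : V)
    (i : ℕ) (σ : SampleTape V) (s : QueryState V) :
    ((sampleStep G c ε δ H x i σ s).cost : ENNReal) +
        potential G c ε (sampleStep G c ε δ H x i σ s).val ≤
      potential G c ε s + sampleCost G c ε δ x σ := by
  classical
  rcases hep : endPoint (walk G c x σ.1.1) with _ | ⟨w, ℓ⟩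
  · simp only [sampleStep, Timed.bind_cost, Timed.bind_val, sampleWalk_val, hep, tick_cost,
      ENat.toENNReal_add, ENat.toENNReal_one, Timed.pure_cost, Timed.pure_val,
      sampleWalk_cost, add_zero, sampleCost]
    rw [add_comm]
    exact add_le_add le_rfl le_self_add
  · have hE := endPoint_eq_some hep
    have hterm : 2 * walkCost G c w σ.1.2.1 + walkCost G c w σ.1.2.2 +
        (2 + ENNReal.ofReal (1 / (numSamples V c ε δ : ℝ)) * indexWeight G c ε (w, ℓ)) +
        backCost G c w ℓ σ.2 ≤
        ∑ w, ∑' ℓ, {ρ | EndsAt (walk G c x ρ) w ℓ}.indicator 1 σ.1.1 *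
          (2 * walkCost G c w σ.1.2.1 + walkCost G c w σ.1.2.2 +
          (2 + ENNReal.ofReal (1 / (numSamples V c ε δ : ℝ)) * indexWeight G c ε (w, ℓ)) +
          backCost G c w ℓ σ.2) := by
      refine le_trans ?_ (Finset.single_le_sum (f := fun w => ∑' ℓ,
        {ρ | EndsAt (walk G c x ρ) w ℓ}.indicator 1 σ.1.1 *
          (2 * walkCost G c w σ.1.2.1 + walkCost G c w σ.1.2.2 +
          (2 + ENNReal.ofReal (1 / (numSamples V c ε δ : ℝ)) * indexWeight G c ε (w, ℓ)) +
          backCost G c w ℓ σ.2)) (fun _ _ => zero_le) (Finset.mem_univ w))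
      refine le_trans ?_ (ENNReal.le_tsum ℓ)
      rw [Set.indicator_of_mem (by exact hE), Pi.one_apply, one_mul]
    rw [sampleCost]
    refine le_trans ?_ (add_le_add le_rfl (add_le_add le_rfl hterm))
    -- The comparison of the two walks is charged to the first one, which therefore counts twice.
    have hcmp : ((({t | walk G c w σ.1.2.1 t ≠ none ∧ walk G c w σ.1.2.2 t ≠ none}).encard : ℕ∞) :
        ENNReal) ≤ walkCost G c w σ.1.2.1 := by
      rw [← sampleWalk_cost, sampleWalk]
      exact ENat.toENNReal_le.2 (Set.encard_le_encard fun t ht => ht.1)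
    by_cases hM : Meet (walk G c w σ.1.2.1) (walk G c w σ.1.2.2)
    · simp only [sampleStep, Timed.bind_cost, Timed.bind_val, sampleWalk_val, hep, tick_cost,
        ENat.toENNReal_add, ENat.toENNReal_one, Timed.pure_cost, Timed.pure_val,
        sampleWalk_cost, add_zero, hM, if_true]
      grw [hcmp]
      calc _ = potential G c ε s + (1 + walkCost G c x σ.1.1 +
            (2 * walkCost G c w σ.1.2.1 + walkCost G c w σ.1.2.2)) := by ring
        _ ≤ _ := by
          rw [add_assoc (2 * _ + _)]
          exact add_le_add le_rfl (add_le_add le_rfl le_self_add)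
    · have hpot := potential_add_single_le G c ε s.etaPi s.sB (w, ℓ)
        (1 / (numSamples V c ε δ : ℝ))
      by_cases hH : w ∈ H
      · simp only [sampleStep, Timed.bind_cost, Timed.bind_val, sampleWalk_val, hep, tick_cost,
          ENat.toENNReal_add, ENat.toENNReal_one, Timed.pure_cost, Timed.pure_val,
          sampleWalk_cost, add_zero, hM, if_false, hH, if_true]
        grw [hcmp, hpot]
        calc _ = potential G c ε s + (1 + walkCost G c x σ.1.1 +
              (2 * walkCost G c w σ.1.2.1 + walkCost G c w σ.1.2.2 + (2 +
              ENNReal.ofReal (1 / (numSamples V c ε δ : ℝ)) * indexWeight G c ε (w, ℓ)))) := by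
                ring
          _ ≤ _ := add_le_add le_rfl (add_le_add le_rfl le_self_add)
      · have hloop := forEach_amortized 1
          (fun (v : V) (m : ℕ × V →₀ ℝ) => do
            tick 1
            pure (m + Finsupp.single (i, v) ((backwardWalk G c w σ.2 ℓ).val v /
              ((1 - √c) ^ 2 * samplesPerRound c ε))))
          (fun m => potential G c ε
            ⟨s.etaPi + Finsupp.single (w, ℓ) (1 / (numSamples V c ε δ : ℝ)), m⟩)
          (fun _ => 3) (backwardWalk G c w σ.2 ℓ).val.support.toList (fun v _ m => by
            simp only [Timed.bind_cost, Timed.bind_val, Timed.pure_cost, Timed.pure_val, tick_cost,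
              add_zero, one_mul, ENat.toENNReal_one, potential]
            grw [card_support_add_single_le m (i, v) _]
            apply le_of_eq
            ring) s.sB
        rw [one_mul, List.map_const', List.sum_replicate, nsmul_eq_mul,
          Finset.length_toList] at hloop
        have hback := backwardWalk_cost_add_le G hc w ℓ σ.2
        simp only [sampleStep, Timed.bind_cost, Timed.bind_val, sampleWalk_val, hep, tick_cost,
          ENat.toENNReal_add, ENat.toENNReal_one, Timed.pure_cost, Timed.pure_val,
          sampleWalk_cost, add_zero, hM, if_false, hH]
        grw [hcmp]
        simp only [add_assoc] at hloop ⊢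
        grw [hloop, hpot, ← hback]
        apply le_of_eq
        ring

/-! ### The whole query -/

/-- The potential starts at 0 and at the end of the sampling covers the median stage, the index
stage and the merging of their outputs, so summing the amortized sample costs suffices. -/
theorem query_cost_le (G : Digraph V) {c ε : ℝ} (hc : c < 1) (hε : 0 < ε) (δ : ℝ) (H : Finset V)
    (x : V) (ω : Tape V) :
    ((query G c ε δ H x ω).cost : ENNReal) ≤ 1 + ∑ i ∈ Finset.range (numRounds V δ),
      ∑ j ∈ Finset.range (samplesPerRound c ε), sampleCost G c ε δ x (ω (i, j)) := by
  have hloop := forEach_amortized 1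
    (fun i s => forEach (fun j s => sampleStep G c ε δ H x i (ω (i, j)) s)
      (List.range (samplesPerRound c ε)) s) (potential G c ε)
    (fun i => ∑ j ∈ Finset.range (samplesPerRound c ε), sampleCost G c ε δ x (ω (i, j)))
    (List.range (numRounds V δ)) (fun i _ s =>
      forEach_amortized 1 (fun j s => sampleStep G c ε δ H x i (ω (i, j)) s) (potential G c ε)
        (fun j => sampleCost G c ε δ x (ω (i, j))) (List.range (samplesPerRound c ε))
        (fun j _ s => by
          rw [one_mul]; exact sampleStep_amortized G hc ε δ H x i (ω (i, j)) s) s)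
    (⟨0, 0⟩ : QueryState V)
  have h0 : potential G c ε (⟨0, 0⟩ : QueryState V) = 0 := by simp [potential]
  have hr : ∀ (g : ℕ → ENNReal) (n : ℕ), ((List.range n).map g).sum = ∑ i ∈ Finset.range n, g i :=
    fun g n => rfl
  rw [h0, zero_add, one_mul, hr] at hloop
  simp only [query, Timed.bind_cost, tick_cost, Timed.pure_cost, add_zero,
    ENat.toENNReal_add, ENat.toENNReal_one]
  refine add_le_add le_rfl (le_trans ?_ hloop)
  refine add_le_add le_rfl ?_
  rw [potential]
  grw [← medianStage_cost_le (numRounds V δ), ← indexStage_cost_le G hc hε H]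
  apply le_of_eq
  push_cast
  ring

/-! ### Expectations -/

/-- The expected number of source nodes, out of all nodes, whose walk terminates at `w`. -/
def totalRank (G : Digraph V) (c : ℝ) (w : V) : ENNReal := ∑ v, ENNReal.ofReal (rppr G c v w)

theorem sum_sum_endProb_le_totalRank (G : Digraph V) (c : ℝ) (w : V) (s : Finset ℕ) :
    ∑ k ∈ s, ∑ v, endProb G c v w k ≤ totalRank G c w := by
  rw [Finset.sum_comm]
  refine Finset.sum_le_sum fun v _ => ?_
  rw [← tsum_endProb]
  exact ENNReal.sum_le_tsum _

theorem indexWeight_le (G : Digraph V) {c ε : ℝ} (hc : c < 1) (hε : 0 < ε) (k : V × ℕ) :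
    indexWeight G c ε k ≤ 2 * (ENNReal.ofReal (rMax c ε))⁻¹ ^ 2 * totalRank G c k.1 := by
  have hr := ENNReal.ofReal_pos.2 (rMax_pos hc hε)
  have h := (length_indexList_le G hc ε k.1 k.2).trans
    (by simpa using sum_sum_endProb_le_totalRank G c k.1 {k.2})
  rw [← ENNReal.le_div_iff_mul_le (Or.inl hr.ne') (Or.inl ENNReal.ofReal_ne_top),
    ENNReal.div_eq_inv_mul] at h
  rw [indexWeight]
  grw [h]
  apply le_of_eq
  ring

theorem measurable_backCost (G : Digraph V) (c : ℝ) (w : V) (ℓ : ℕ) :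
    Measurable (backCost G c w ℓ) :=
  measurable_const.add (measurable_const.mul
    (Finset.measurable_sum _ fun k _ => measurable_totalEstimate G c w k))

theorem lintegral_backCost_le (G : Digraph V) {c : ℝ} (hc : c < 1) (w : V) (ℓ : ℕ) :
    ∫⁻ β, backCost G c w ℓ β ∂backMeasure V ≤
      (ℓ + 1 : ℕ) + 4 * (ENNReal.ofReal (1 - √c))⁻¹ * totalRank G c w := by
  have hm : ∀ k ∈ Finset.range (ℓ + 1), Measurable fun β => totalEstimate G c w β k :=
    fun k _ => measurable_totalEstimate G c w k
  simp only [backCost]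
  rw [lintegral_add_left measurable_const, lintegral_const, measure_univ, mul_one,
    lintegral_const_mul _ (Finset.measurable_sum _ hm), lintegral_finsetSum _ hm]
  gcongr
  refine le_trans ?_ (sum_sum_endProb_le_totalRank G c w (Finset.range (ℓ + 1)))
  exact Finset.sum_le_sum fun k _ => lintegral_totalEstimate_le G hc w k

/-- The walk from the query node, the two walks from its end point and the backward walk use
independent tapes. Once (w, ℓ) is fixed, the event of ending there thus decouples from the cost it
causes. -/
theorem lintegral_sample_mul {f : WalkTape → ENNReal} {g : WalkTape × WalkTape → ENNReal}
    {h : BackTape V → ENNReal} (hf : Measurable f) (hg : Measurable g) (hh : Measurable h) :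
    ∫⁻ σ : SampleTape V, f σ.1.1 * (g σ.1.2 + h σ.2) ∂sampleMeasure V =
      (∫⁻ ρ, f ρ ∂walkMeasure) *
        (∫⁻ p, g p ∂(walkMeasure.prod walkMeasure) + ∫⁻ β, h β ∂backMeasure V) := by
  have hm : Measurable fun σ : SampleTape V => f σ.1.1 * (g σ.1.2 + h σ.2) := by fun_prop
  rw [sampleMeasure, lintegral_prod _ hm.aemeasurable]
  have h1 : ∀ p : WalkTape × WalkTape × WalkTape,
      ∫⁻ β, f p.1 * (g p.2 + h β) ∂backMeasure V =
        f p.1 * (g p.2 + ∫⁻ β, h β ∂backMeasure V) := fun p => by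
    have hm' : Measurable fun β => g p.2 + h β := measurable_const.add hh
    rw [lintegral_const_mul _ hm', lintegral_add_left measurable_const, lintegral_const,
      measure_univ, mul_one]
  have hg' : Measurable fun p => g p + ∫⁻ β, h β ∂backMeasure V := hg.add measurable_const
  simp only [h1]
  rw [lintegral_prod_mul hf.aemeasurable hg'.aemeasurable, lintegral_add_right _ measurable_const, lintegral_const, measure_univ, mul_one]

theorem lintegral_two_walks_le (G : Digraph V) {c : ℝ} (hc : c ≤ 1) (w : V) (C : ENNReal) :
    ∫⁻ p, (2 * walkCost G c w p.1 + walkCost G c w p.2 + C) ∂(walkMeasure.prod walkMeasure) ≤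
      3 * (ENNReal.ofReal (1 - √c))⁻¹ + C := by
  have hm := measurable_walkCost G c w
  have h1 : Measurable fun p : WalkTape × WalkTape => walkCost G c w p.1 := hm.comp measurable_fst
  have h2 : Measurable fun p : WalkTape × WalkTape => walkCost G c w p.2 := hm.comp measurable_snd
  rw [lintegral_add_right _ measurable_const, lintegral_add_right _ h2, lintegral_const_mul _ h1,
    measurePreserving_fst.lintegral_comp hm, measurePreserving_snd.lintegral_comp hm,
    lintegral_const, measure_univ, mul_one]
  grw [lintegral_walkCost_le G hc w]
  apply le_of_eq
  ring

theorem measurable_sampleCost (G : Digraph V) (c ε δ : ℝ) (x : V) :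
    Measurable (sampleCost G c ε δ x) := by
  refine (measurable_const.add ((measurable_walkCost G c x).comp (by fun_prop))).add ?_
  refine Finset.measurable_sum _ fun w _ => Measurable.tsum fun ℓ => Measurable.mul ?_ ?_
  · exact (measurable_one.indicator (measurableSet_endsAt G c x w ℓ)).comp
      (measurable_fst.comp measurable_fst)
  · refine Measurable.add (Measurable.add (Measurable.add ?_ ?_) measurable_const) ?_
    · exact measurable_const.mul ((measurable_walkCost G c w).comp (by fun_prop))
    · exact (measurable_walkCost G c w).comp (by fun_prop)
    · exact (measurable_backCost G c w ℓ).comp measurable_snd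

theorem sum_tsum_endProb_mul_le (G : Digraph V) {c : ℝ} (hc : c ≤ 1) (x : V) :
    ∑ w, ∑' ℓ : ℕ, endProb G c x w ℓ * (ℓ + 1 : ℕ) ≤
      ∑' ℓ : ℕ, ENNReal.ofReal √c ^ ℓ * (ℓ + 1 : ℕ) := by
  rw [← Summable.tsum_finsetSum fun _ _ => ENNReal.summable]
  refine ENNReal.tsum_le_tsum fun ℓ => ?_
  rw [← Finset.sum_mul]
  gcongr
  exact (Finset.sum_le_sum fun w _ => endProb_le_hopProb G hc x w ℓ).trans (sum_hopProb_le G c ℓ x)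

/-- The part of the expected cost of a sample that does not depend on the graph. -/
def baseCost (c : ℝ) : ENNReal :=
  1 + (ENNReal.ofReal (1 - √c))⁻¹ + (3 * (ENNReal.ofReal (1 - √c))⁻¹ + 3) *
    ∑' ℓ : ℕ, ENNReal.ofReal √c ^ ℓ * (ℓ + 1 : ℕ)

/-- Conditioning on the end (w, ℓ), the expected cost is O(ℓ + 1) plus a multiple of `totalRank` at
w. The first part sums to a bound depending on c only; in the second, summing over ℓ turns the end
probabilities into π(x,w). -/
theorem lintegral_sampleCost_le (G : Digraph V) {c ε : ℝ} (hc : c < 1) (hε : 0 < ε) (δ : ℝ)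
    (x : V) :
    ∫⁻ σ, sampleCost G c ε δ x σ ∂sampleMeasure V ≤ baseCost c +
      (4 * (ENNReal.ofReal (1 - √c))⁻¹ + ENNReal.ofReal (1 / (numSamples V c ε δ : ℝ)) *
        (2 * (ENNReal.ofReal (rMax c ε))⁻¹ ^ 2)) *
      ∑ w, ENNReal.ofReal (rppr G c x w) * totalRank G c w := by
  set A := (ENNReal.ofReal (1 - √c))⁻¹ with hA
  set B := ENNReal.ofReal (1 / (numSamples V c ε δ : ℝ)) with hB
  set R := 2 * (ENNReal.ofReal (rMax c ε))⁻¹ ^ 2 with hR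
  set S := ∑' ℓ : ℕ, ENNReal.ofReal √c ^ ℓ * (ℓ + 1 : ℕ) with hS
  have hterm : ∀ w ℓ, ∫⁻ σ : SampleTape V, {ρ | EndsAt (walk G c x ρ) w ℓ}.indicator 1 σ.1.1 *
      (2 * walkCost G c w σ.1.2.1 + walkCost G c w σ.1.2.2 + (2 + B * indexWeight G c ε (w, ℓ)) +
        backCost G c w ℓ σ.2) ∂sampleMeasure V ≤
      endProb G c x w ℓ * (ℓ + 1 : ℕ) * (3 * A + 3) +
        endProb G c x w ℓ * ((4 * A + B * R) * totalRank G c w) := by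
    intro w ℓ
    rw [lintegral_sample_mul (measurable_one.indicator (measurableSet_endsAt G c x w ℓ))
      (g := fun p => 2 * walkCost G c w p.1 + walkCost G c w p.2 +
        (2 + B * indexWeight G c ε (w, ℓ)))
      (((((measurable_walkCost G c w).comp measurable_fst).const_mul 2).add
        ((measurable_walkCost G c w).comp measurable_snd)).add measurable_const)
      (measurable_backCost G c w ℓ),
      lintegral_indicator_one (measurableSet_endsAt G c x w ℓ)]
    grw [lintegral_two_walks_le G hc.le w, lintegral_backCost_le G hc w ℓ,
      indexWeight_le G hc hε (w, ℓ)]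
    rw [← endProb, ← hA, ← hR, mul_assoc (endProb G c x w ℓ), ← mul_add]
    refine mul_le_mul' le_rfl ?_
    -- The terms independent of `ℓ` are inflated by the factor ℓ + 1, so that one series handles
    -- them all.
    have h1 : (1 : ENNReal) ≤ (ℓ + 1 : ℕ) := by exact_mod_cast Nat.succ_pos ℓ
    calc _ = 1 * (3 * A + 2) + (ℓ + 1 : ℕ) + (4 * A + B * R) * totalRank G c w := by ring
      _ ≤ (ℓ + 1 : ℕ) * (3 * A + 2) + (ℓ + 1 : ℕ) + (4 * A + B * R) * totalRank G c w := by
        gcongr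
      _ = _ := by ring
  have hmt : ∀ w ℓ, Measurable fun σ : SampleTape V =>
      {ρ | EndsAt (walk G c x ρ) w ℓ}.indicator (1 : WalkTape → ENNReal) σ.1.1 *
      (2 * walkCost G c w σ.1.2.1 + walkCost G c w σ.1.2.2 + (2 + B * indexWeight G c ε (w, ℓ)) +
        backCost G c w ℓ σ.2) := by
    intro w ℓ
    refine Measurable.mul ?_ (Measurable.add (Measurable.add (Measurable.add ?_ ?_)
      measurable_const) ?_)
    · exact (measurable_one.indicator (measurableSet_endsAt G c x w ℓ)).comp
        (measurable_fst.comp measurable_fst)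
    · exact measurable_const.mul ((measurable_walkCost G c w).comp (by fun_prop))
    · exact (measurable_walkCost G c w).comp (by fun_prop)
    · exact (measurable_backCost G c w ℓ).comp measurable_snd
  have hw : Measurable fun σ : SampleTape V => 1 + walkCost G c x σ.1.1 :=
    measurable_const.add ((measurable_walkCost G c x).comp (measurable_fst.comp measurable_fst))
  have hw1 : ∫⁻ σ : SampleTape V, 1 + walkCost G c x σ.1.1 ∂sampleMeasure V ≤ 1 + A := by
    have hm := measurable_walkCost G c x
    rw [lintegral_add_left measurable_const, lintegral_const, measure_univ, mul_one, sampleMeasure,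
      measurePreserving_fst.lintegral_comp
        (f := fun p : WalkTape × WalkTape × WalkTape => walkCost G c x p.1)
        (hm.comp measurable_fst), measurePreserving_fst.lintegral_comp hm]
    gcongr
    exact lintegral_walkCost_le G hc.le x
  simp only [sampleCost]
  rw [lintegral_add_left hw, lintegral_finsetSum _ fun w _ => Measurable.tsum fun ℓ => hmt w ℓ]
  simp_rw [lintegral_tsum fun ℓ => (hmt _ ℓ).aemeasurable]
  calc _ ≤ (1 + A) + ∑ w, ∑' ℓ : ℕ, (endProb G c x w ℓ * (ℓ + 1 : ℕ) * (3 * A + 3) +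
        endProb G c x w ℓ * ((4 * A + B * R) * totalRank G c w)) := by
        gcongr with w _ ℓ
        exact hterm w ℓ
    _ = (1 + A) + ((∑ w, ∑' ℓ : ℕ, endProb G c x w ℓ * (ℓ + 1 : ℕ)) * (3 * A + 3) +
        (4 * A + B * R) * ∑ w, ENNReal.ofReal (rppr G c x w) * totalRank G c w) := by
        simp_rw [ENNReal.tsum_add, ENNReal.tsum_mul_right, tsum_endProb]
        rw [Finset.sum_add_distrib, Finset.sum_mul, Finset.mul_sum]
        congr 3
        funext w
        ring
    _ ≤ (1 + A) + (S * (3 * A + 3) +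
        (4 * A + B * R) * ∑ w, ENNReal.ofReal (rppr G c x w) * totalRank G c w) := by
        gcongr
        exact sum_tsum_endProb_mul_le G hc.le x
    _ = _ := by rw [baseCost, ← hA, ← hS]; ring

theorem lintegral_query_cost_le (G : Digraph V) {c ε : ℝ} (hc : c < 1) (hε : 0 < ε) (δ : ℝ)
    (H : Finset V) (x : V) :
    ∫⁻ ω, ((query G c ε δ H x ω).cost : ENNReal) ∂tapeMeasure V ≤
      1 + numSamples V c ε δ * baseCost c +
      (numSamples V c ε δ * (4 * (ENNReal.ofReal (1 - √c))⁻¹) +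
        2 * (ENNReal.ofReal (rMax c ε))⁻¹ ^ 2) *
      ∑ w, ENNReal.ofReal (rppr G c x w) * totalRank G c w := by
  have hm := measurable_sampleCost G c ε δ x
  have hm' : ∀ k : ℕ × ℕ, Measurable fun ω : Tape V => sampleCost G c ε δ x (ω k) :=
    fun k => hm.comp (measurable_pi_apply k)
  have he : ∀ k : ℕ × ℕ, ∫⁻ ω : Tape V, sampleCost G c ε δ x (ω k) ∂tapeMeasure V =
      ∫⁻ σ, sampleCost G c ε δ x σ ∂sampleMeasure V := fun k =>
    (measurePreserving_eval_infinitePi (fun _ : ℕ × ℕ => sampleMeasure V) k).lintegral_comp hm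
  -- All samples together add at most 1 to the estimates, so the index term loses its factor n_r;
  -- the inequality also covers zero samples.
  have hN : (numSamples V c ε δ : ENNReal) * ENNReal.ofReal (1 / (numSamples V c ε δ : ℝ)) ≤ 1 := by
    rw [← ENNReal.ofReal_natCast, ← ENNReal.ofReal_mul (Nat.cast_nonneg _)]
    exact ENNReal.ofReal_le_one.2 (by rw [mul_one_div]; exact div_self_le_one _)
  refine (lintegral_mono fun ω => query_cost_le G hc hε δ H x ω).trans ?_
  rw [lintegral_add_left measurable_const, lintegral_const, measure_univ, mul_one,
    lintegral_finsetSum _ fun i _ => Finset.measurable_sum _ fun j _ => hm' (i, j)]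
  simp_rw [lintegral_finsetSum _ fun j _ => hm' (_, j), he]
  rw [Finset.sum_const, Finset.sum_const, Finset.card_range, Finset.card_range, smul_smul,
    mul_comm (numRounds V δ), ← numSamples, nsmul_eq_mul]
  grw [lintegral_sampleCost_le G hc hε δ x]
  set Q := ∑ w, ENNReal.ofReal (rppr G c x w) * totalRank G c w
  calc _ = 1 + numSamples V c ε δ * baseCost c +
        (numSamples V c ε δ * (4 * (ENNReal.ofReal (1 - √c))⁻¹) +
        (numSamples V c ε δ * ENNReal.ofReal (1 / (numSamples V c ε δ : ℝ))) *
        (2 * (ENNReal.ofReal (rMax c ε))⁻¹ ^ 2)) * Q := by ring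
    _ ≤ _ := by grw [hN, one_mul]

/-! ### The average over the query nodes -/

theorem rppr_nonneg (G : Digraph V) (c : ℝ) (v w : V) : 0 ≤ rppr G c v w := measureReal_nonneg

theorem reversePageRank_nonneg (G : Digraph V) (c : ℝ) (w : V) : 0 ≤ reversePageRank G c w :=
  div_nonneg (Finset.sum_nonneg fun v _ => rppr_nonneg G c v w) (Nat.cast_nonneg _)

theorem totalRank_eq (G : Digraph V) (c : ℝ) (hn : 0 < Fintype.card V) (w : V) :
    totalRank G c w = ENNReal.ofReal (Fintype.card V * reversePageRank G c w) := by
  have hn' : (0 : ℝ) < Fintype.card V := by exact_mod_cast hn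
  rw [totalRank, ← ENNReal.ofReal_sum_of_nonneg fun v _ => rppr_nonneg G c v w, reversePageRank,
    mul_div_cancel₀ _ hn'.ne']

/-- Counting only the walks that stop at their source without a step is enough, and avoids almost
sure termination. -/
theorem one_sub_sqrt_le_sum_reversePageRank (G : Digraph V) {c : ℝ} (hc : c ≤ 1)
    (hn : 0 < Fintype.card V) : 1 - √c ≤ ∑ w, reversePageRank G c w := by
  have hn' : (0 : ℝ) < Fintype.card V := by exact_mod_cast hn
  have h1 : ∀ x, 1 - √c ≤ rppr G c x x := fun x => by
    have h2 := (mul_hopProb_le_endProb G hc x x 0).trans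
      ((ENNReal.le_tsum 0).trans (tsum_endProb G c x x).le)
    rw [hopProb, if_pos rfl, mul_one] at h2
    exact (ENNReal.ofReal_le_ofReal_iff (rppr_nonneg G c x x)).1 h2
  simp only [reversePageRank]
  rw [← Finset.sum_div, le_div_iff₀ hn', Finset.sum_comm]
  calc (1 - √c) * Fintype.card V = ∑ _x : V, (1 - √c) := by
        rw [Finset.sum_const, Finset.card_univ, nsmul_eq_mul, mul_comm]
    _ ≤ _ := Finset.sum_le_sum fun x _ => (h1 x).trans
        (Finset.single_le_sum (fun w _ => rppr_nonneg G c x w) (Finset.mem_univ x))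

theorem sq_le_card_mul_sum_reversePageRank_sq (G : Digraph V) {c : ℝ} (hc : c ≤ 1)
    (hn : 0 < Fintype.card V) :
    (1 - √c) ^ 2 ≤ Fintype.card V * ∑ w, reversePageRank G c w ^ 2 := by
  have h := one_sub_sqrt_le_sum_reversePageRank G hc hn
  have hq : 0 ≤ 1 - √c := sub_nonneg.2 (Real.sqrt_le_one.2 hc)
  calc (1 - √c) ^ 2 ≤ (∑ w, reversePageRank G c w) ^ 2 := by gcongr
    _ ≤ _ := by
      have := sq_sum_le_card_mul_sum_sq (s := Finset.univ) (f := fun w => reversePageRank G c w)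
      simpa using this

/-- Summing π(x,w) over all query nodes x yields nπ(w) once more, so the product with `totalRank`
becomes n²π(w)²; dividing by n gives n∑π(w)². -/
theorem expectedQueryCost_le (G : Digraph V) {c ε : ℝ} (hc : c < 1) (hε : 0 < ε) (δ : ℝ)
    (H : Finset V) (hn : 0 < Fintype.card V) :
    expectedQueryCost G c ε δ H ≤ 1 + numSamples V c ε δ * baseCost c +
      (numSamples V c ε δ * (4 * (ENNReal.ofReal (1 - √c))⁻¹) +
        2 * (ENNReal.ofReal (rMax c ε))⁻¹ ^ 2) *
      ENNReal.ofReal (Fintype.card V * ∑ w, reversePageRank G c w ^ 2) := by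
  have hn' : (0 : ℝ) < Fintype.card V := by exact_mod_cast hn
  have hn0 : (Fintype.card V : ENNReal) ≠ 0 := by exact_mod_cast hn.ne'
  have hnt : (Fintype.card V : ENNReal) ≠ ⊤ := ENNReal.natCast_ne_top _
  rw [expectedQueryCost, ENNReal.div_le_iff hn0 hnt]
  refine (Finset.sum_le_sum fun x _ => lintegral_query_cost_le G hc hε δ H x).trans (le_of_eq ?_)
  rw [Finset.sum_add_distrib, ← Finset.mul_sum, Finset.sum_const, Finset.card_univ, nsmul_eq_mul,
    Finset.sum_comm]
  have h1 : ∑ w, ∑ x, ENNReal.ofReal (rppr G c x w) * totalRank G c w =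
      ENNReal.ofReal (Fintype.card V * ∑ w, reversePageRank G c w ^ 2) * Fintype.card V := by
    simp_rw [← Finset.sum_mul]
    rw [← ENNReal.ofReal_natCast, ← ENNReal.ofReal_mul (by
      exact mul_nonneg hn'.le (Finset.sum_nonneg fun w _ => sq_nonneg _)), Finset.mul_sum,
      Finset.sum_mul, ENNReal.ofReal_sum_of_nonneg fun w _ => by positivity]
    refine Finset.sum_congr rfl fun w _ => ?_
    rw [← totalRank, totalRank_eq G c hn, ← ENNReal.ofReal_mul
      (mul_nonneg hn'.le (reversePageRank_nonneg G c w))]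
    congr 1
    ring
  rw [h1]
  ring

/-! ### Absorbing the constants -/

theorem baseCost_ne_top {c : ℝ} (hc : c < 1) : baseCost c ≠ ⊤ := by
  have hq := one_sub_sqrt_pos hc
  have hA : (ENNReal.ofReal (1 - √c))⁻¹ ≠ ⊤ := ENNReal.inv_ne_top.2 (ENNReal.ofReal_pos.2 hq).ne'
  have hS : ∑' ℓ : ℕ, ENNReal.ofReal √c ^ ℓ * (ℓ + 1 : ℕ) ≠ ⊤ := by
    have hs : Summable fun ℓ : ℕ => √c ^ ℓ * ((ℓ + 1 : ℕ) : ℝ) := by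
      have hlt : ‖√c‖ < 1 := by
        rw [Real.norm_of_nonneg (Real.sqrt_nonneg c)]; linarith
      have h1 := summable_pow_mul_geometric_of_norm_lt_one 1 hlt
      have h2 := summable_geometric_of_norm_lt_one hlt
      refine (h1.add h2).congr fun ℓ => ?_
      push_cast
      ring
    have h3 : ∀ ℓ : ℕ, ENNReal.ofReal √c ^ ℓ * ((ℓ + 1 : ℕ) : ENNReal) =
        ENNReal.ofReal (√c ^ ℓ * ((ℓ + 1 : ℕ) : ℝ)) := fun ℓ => by
      rw [ENNReal.ofReal_mul (by positivity), ENNReal.ofReal_pow (Real.sqrt_nonneg c),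
        ENNReal.ofReal_natCast]
    simp_rw [h3]
    rw [← ENNReal.ofReal_tsum_of_nonneg (fun ℓ => by positivity) hs]
    exact ENNReal.ofReal_ne_top
  unfold baseCost
  finiteness

theorem numSamples_le {c ε δ : ℝ} (hc : c < 1) (hε : 0 < ε) (hε1 : ε ≤ 1) (hδ : 0 < δ)
    (hδ1 : δ ≤ 1) (hn : 2 ≤ Fintype.card V) :
    1 / 2 ≤ Real.log (Fintype.card V / δ) / ε ^ 2 ∧
    (numSamples V c ε δ : ℝ) ≤ 5 * (c₁ c + 1) * (Real.log (Fintype.card V / δ) / ε ^ 2) := by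
  have hq := one_sub_sqrt_pos hc
  have hn' : (2 : ℝ) ≤ Fintype.card V := by exact_mod_cast hn
  have hL : 1 / 2 ≤ Real.log (Fintype.card V / δ) := by
    have h1 : (2 : ℝ) ≤ Fintype.card V / δ := by
      rw [le_div_iff₀ hδ]; nlinarith
    have := Real.log_le_log (by norm_num) h1
    linarith [Real.log_two_gt_d9]
  set L := Real.log (Fintype.card V / δ)
  have hε2 : ε ^ 2 ≤ 1 := pow_le_one₀ hε.le hε1
  have hc1 : 0 ≤ c₁ c := by unfold c₁; positivity
  constructor
  · rw [le_div_iff₀ (by positivity)]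
    nlinarith
  · have h1 : (samplesPerRound c ε : ℝ) ≤ (c₁ c + 1) / ε ^ 2 := by
      refine (Nat.ceil_lt_add_one (by positivity)).le.trans ?_
      rw [add_div]
      gcongr
      exact (one_le_div (by positivity)).2 hε2
    -- 5 = 3 + 2: rounding up adds at most 1, and 1 ≤ 2L.
    have h2 : (numRounds V δ : ℝ) ≤ 5 * L := by
      refine (Nat.ceil_lt_add_one (by positivity)).le.trans ?_
      linarith
    rw [numSamples, Nat.cast_mul]
    calc _ ≤ (c₁ c + 1) / ε ^ 2 * (5 * L) := by gcongr
      _ = _ := by ring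

end PRSim

end

theorem mainTheorem2 (c : ℝ) (hc0 : 0 < c) (hc1 : c < 1) :
    ∃ K : ℝ, 0 < K ∧
      ∀ (V : Type*) [Fintype V] (_ : 2 ≤ Fintype.card V) (G : Digraph V)
        (ε δ : ℝ) (_ : 0 < ε) (_ : ε ≤ 1) (_ : 0 < δ) (_ : δ ≤ 1)
        (j₀ : ℕ) (H : Finset V) (_ : PRSim.IsHubSet G c j₀ H),
        PRSim.expectedQueryCost G c ε δ H ≤
          ENNReal.ofReal (K * ((Fintype.card V * Real.log (Fintype.card V / δ)) / ε ^ 2 *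
            ∑ w : V, PRSim.reversePageRank G c w ^ 2)) := by
  have hq := PRSim.one_sub_sqrt_pos hc1
  have hcc : 0 < PRSim.c₁ c := by unfold PRSim.c₁; positivity
  set b := (PRSim.baseCost c).toReal with hb
  have hb0 : 0 ≤ b := ENNReal.toReal_nonneg
  -- The first summand is the graph-independent cost, made proportional to z = n∑π(w)² by z ≥ (1 -
  -- √c)². In the second, 20 = 5 · 4 comes from the backward walks and 4c₁² from the index.
  refine ⟨(2 + 5 * (PRSim.c₁ c + 1) * b) / (1 - √c) ^ 2 +
    (20 * (PRSim.c₁ c + 1) / (1 - √c) + 4 * PRSim.c₁ c ^ 2), by positivity, ?_⟩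
  intro V _ hn G ε δ hε hε1 hδ hδ1 j₀ H _
  obtain ⟨hY, hN⟩ := PRSim.numSamples_le (V := V) hc1 hε hε1 hδ hδ1 hn
  have hz := PRSim.sq_le_card_mul_sum_reversePageRank_sq G hc1.le (two_pos.trans_le hn)
  have hL := Real.log_nonneg (x := Fintype.card V / δ) (by
    rw [le_div_iff₀ hδ, one_mul]
    exact hδ1.trans (by exact_mod_cast one_le_two.trans hn))
  refine (PRSim.expectedQueryCost_le G hc1 hε δ H (two_pos.trans_le hn)).trans ?_
  set z := (Fintype.card V : ℝ) * ∑ w, PRSim.reversePageRank G c w ^ 2 with hzdef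
  have hz0 : 0 ≤ z := (sq_nonneg _).trans hz
  clear_value z
  set N := PRSim.numSamples V c ε δ
  set Y := Real.log (Fintype.card V / δ) / ε ^ 2 with hYdef
  have hbE : PRSim.baseCost c = ENNReal.ofReal b :=
    (ENNReal.ofReal_toReal (PRSim.baseCost_ne_top hc1)).symm
  have hrm := PRSim.rMax_pos hc1 hε
  have hE : 1 + (N : ENNReal) * PRSim.baseCost c +
      (N * (4 * (ENNReal.ofReal (1 - √c))⁻¹) + 2 * (ENNReal.ofReal (PRSim.rMax c ε))⁻¹ ^ 2) *
      ENNReal.ofReal z = ENNReal.ofReal (1 + N * b +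
        (N * (4 * (1 - √c)⁻¹) + 2 * (PRSim.rMax c ε)⁻¹ ^ 2) * z) := by
    rw [hbE, ENNReal.ofReal_add (by positivity) (by positivity),
      ENNReal.ofReal_add (by positivity) (by positivity), ENNReal.ofReal_mul (by positivity),
      ENNReal.ofReal_mul (by positivity), ENNReal.ofReal_add (by positivity) (by positivity),
      ENNReal.ofReal_mul (by positivity), ENNReal.ofReal_mul (by positivity),
      ENNReal.ofReal_mul (by positivity), ENNReal.ofReal_pow (by positivity),
      ENNReal.ofReal_inv_of_pos hq, ENNReal.ofReal_inv_of_pos hrm, ENNReal.ofReal_natCast]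
    simp
  rw [hE]
  refine ENNReal.ofReal_le_ofReal ?_
  have hr : 2 * (PRSim.rMax c ε)⁻¹ ^ 2 ≤ 4 * PRSim.c₁ c ^ 2 * Y := by
    have hε2 : (1 : ℝ) / 2 ≤ Real.log (Fintype.card V / δ) := by
      -- Taking ε = 1 isolates the bound on the logarithm.
      have := (PRSim.numSamples_le (V := V) hc1 one_pos le_rfl hδ hδ1 hn).1
      simpa using this
    have h1 : 1 / ε ^ 2 ≤ 2 * Y := by
      rw [hYdef, mul_div_assoc']
      gcongr
      linarith
    calc 2 * (PRSim.rMax c ε)⁻¹ ^ 2 = 2 * PRSim.c₁ c ^ 2 * (1 / ε ^ 2) := by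
          rw [PRSim.rMax, inv_div, div_pow]; ring
      _ ≤ 2 * PRSim.c₁ c ^ 2 * (2 * Y) := by gcongr
      _ = _ := by ring
  have hone : 1 + N * b ≤ (2 + 5 * (PRSim.c₁ c + 1) * b) / (1 - √c) ^ 2 * Y * z := by
    calc 1 + N * b ≤ 2 * Y + 5 * (PRSim.c₁ c + 1) * Y * b := by gcongr; linarith
      _ = (2 + 5 * (PRSim.c₁ c + 1) * b) / (1 - √c) ^ 2 * Y * (1 - √c) ^ 2 := by
        field_simp
      _ ≤ _ := by gcongr
  calc _ ≤ (2 + 5 * (PRSim.c₁ c + 1) * b) / (1 - √c) ^ 2 * Y * z +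
        (5 * (PRSim.c₁ c + 1) * Y * (4 * (1 - √c)⁻¹) + 4 * PRSim.c₁ c ^ 2 * Y) * z := by gcongr
    _ = _ := by rw [hYdef, hzdef]; field_simp; ring
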